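/- Let $A$ be a separable C$^*$-algebra, let $F$ be a countably generated (right) Hilbert $A$-module, and let $E\subset F$ be a Hilbert submodule that is compactly contained in $F$, written $E\subset\subset F$: there is a self-adjoint "compact" operator $T\in\mathcal K(F)$ with $T|_E=\mathrm{id}_E$, where $\mathcal K(F)$ is the closed linear span, in the algebra of adjointable operators on $F$, of the operators $z\mapsto x\langle y,z\rangle$ $(x,y\in F)$. Let $\mathcal K$ denote the compact operators on $\ell^2(\mathbb N)$. An element $x$ of a C$^*$-algebra is called a scaling element if $(x^*x)(xx^*)=xx^*$ and $x^*x\neq xx^*$. A unital C$^*$-algebra $B$ is called stably finite if no $M_n(B)$, $n\in\mathbb N$, contains an infinite projection (one that is Murray--von Neumann equivalent to a proper subprojection of itself); a nonunital C$^*$-algebra is called stably finite if its unitization is. 1. If $E\cong F$ (as Hilbert $A$-modules, by an $A$-linear bijection preserving the $A$-valued inner products), then either $E=F$ or $A\otimes\mathcal K$ contains a scaling element. 2. If $A$ is stably finite, then $A\otimes\mathcal K$ contains no scaling element; hence, in this case, $E\cong F$ if and only if $E=F$. -/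

import Mathlib

/-!
Right Hilbert modules over a C⋆-algebra `A` are expressed through Mathlib's `CStarModule`.
The axioms of `CStarModule B E` read `⟪x, b • y⟫ = b * ⟪x, y⟫`, so that a *right* Hilbert
`A`-module `E` is a complete `CStarModule Aᵐᵒᵖ E`: the right action is `x · a = op a • x`, and
the `A`-valued inner product is `rinner A x y`, linear in the second variable.
-/

namespace HilbertMod

open MulOpposite

set_option linter.unusedSectionVars false

section Basic

variable (A : Type*) [NonUnitalCStarAlgebra A] [PartialOrder A] [StarOrderedRing A]
variable {E : Type*} [NormedAddCommGroup E] [NormedSpace ℂ E] [SMul Aᵐᵒᵖ E] [CStarModule Aᵐᵒᵖ E]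

/-- The `A`-valued inner product of a right Hilbert `A`-module. -/
def rinner (x y : E) : A := unop (inner Aᵐᵒᵖ x y)

theorem rinner_smul_right (a : A) (x y : E) : rinner A x (op a • y) = rinner A x y * a := by
  simp [rinner]

theorem rinner_star (x y : E) : star (rinner A x y) = rinner A y x := by
  simp [rinner, ← unop_star]

theorem rinner_add_right (x y z : E) : rinner A x (y + z) = rinner A x y + rinner A x z := by
  simp [rinner]

theorem rinner_add_left (x y z : E) : rinner A (x + y) z = rinner A x z + rinner A y z := by
  simp [rinner]

theorem rinner_sub_left (x y z : E) : rinner A (x - y) z = rinner A x z - rinner A y z := by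
  simp [rinner]

theorem rinner_smul_complex (c : ℂ) (x y : E) : rinner A x (c • y) = c • rinner A x y := by
  simp [rinner]

theorem rinner_smul_complex_left (c : ℂ) (x y : E) :
    rinner A (c • x) y = star c • rinner A x y := by
  simp [rinner]

theorem rinner_zero_left (y : E) : rinner A (0 : E) y = 0 := by
  simp [rinner]

theorem norm_sq_rinner (x : E) : ‖x‖ ^ 2 = ‖rinner A x x‖ := by
  rw [CStarModule.norm_sq_eq Aᵐᵒᵖ]; rfl

theorem norm_rinner_le (x y : E) : ‖rinner A x y‖ ≤ ‖x‖ * ‖y‖ :=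
  CStarModule.norm_inner_le (A := Aᵐᵒᵖ) E

theorem ext_rinner {x y : E} (h : ∀ z, rinner A x z = rinner A y z) : x = y := by
  rw [← sub_eq_zero, ← norm_eq_zero, ← sq_eq_zero_iff, norm_sq_rinner A, rinner_sub_left, h,
    sub_self, norm_zero]

/-- `S` is an adjoint of `T` for the `A`-valued inner product. -/
def IsAdjointPair (T S : E →L[ℂ] E) : Prop := ∀ x y, rinner A (T x) y = rinner A x (S y)

variable {A}

theorem IsAdjointPair.symm {T S : E →L[ℂ] E} (h : IsAdjointPair A T S) : IsAdjointPair A S T := by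
  intro x y
  rw [← rinner_star, ← h, rinner_star]

theorem IsAdjointPair.unique {T S S' : E →L[ℂ] E} (h : IsAdjointPair A T S)
    (h' : IsAdjointPair A T S') : S = S' := by
  ext y
  refine ext_rinner A fun z => ?_
  rw [h.symm, h'.symm]

theorem IsAdjointPair.norm_le {T S : E →L[ℂ] E} (h : IsAdjointPair A T S) : ‖S‖ ≤ ‖T‖ := by
  refine S.opNorm_le_bound (norm_nonneg _) fun x => ?_
  by_cases hx : ‖S x‖ = 0
  · rw [hx]; positivity
  have hpos : 0 < ‖S x‖ := lt_of_le_of_ne (norm_nonneg _) (Ne.symm hx)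
  have h1 : ‖S x‖ ^ 2 ≤ ‖T‖ * ‖x‖ * ‖S x‖ := by
    rw [norm_sq_rinner A, ← h (S x) x]
    calc ‖rinner A (T (S x)) x‖ ≤ ‖T (S x)‖ * ‖x‖ := norm_rinner_le A _ _
      _ ≤ ‖T‖ * ‖S x‖ * ‖x‖ := by gcongr; exact T.le_opNorm _
      _ = ‖T‖ * ‖x‖ * ‖S x‖ := by ring
  rw [sq] at h1
  exact le_of_mul_le_mul_right h1 hpos

theorem IsAdjointPair.add {T S T' S' : E →L[ℂ] E} (h : IsAdjointPair A T S)
    (h' : IsAdjointPair A T' S') : IsAdjointPair A (T + T') (S + S') := by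
  intro x y
  simp [rinner_add_left, rinner_add_right, h x y, h' x y]

theorem IsAdjointPair.mul {T S T' S' : E →L[ℂ] E} (h : IsAdjointPair A T S)
    (h' : IsAdjointPair A T' S') : IsAdjointPair A (T * T') (S' * S) := by
  intro x y
  simp [h (T' x) y, h' x (S y)]

theorem IsAdjointPair.algebraMap (c : ℂ) :
    IsAdjointPair A (algebraMap ℂ (E →L[ℂ] E) c) (algebraMap ℂ (E →L[ℂ] E) (star c)) := by
  intro x y
  simp only [Algebra.algebraMap_eq_smul_one, smul_apply, one_apply_eq_self]
  rw [rinner_smul_complex, rinner_smul_complex_left]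

variable (A E)

/-- The bounded operators on `E` that have an adjoint, as a subalgebra. -/
def adjointableSubalgebra : Subalgebra ℂ (E →L[ℂ] E) where
  carrier := {T | ∃ S, IsAdjointPair A T S}
  mul_mem' := fun ⟨_, h⟩ ⟨_, h'⟩ => ⟨_, h.mul h'⟩
  add_mem' := fun ⟨_, h⟩ ⟨_, h'⟩ => ⟨_, h.add h'⟩
  algebraMap_mem' c := ⟨_, IsAdjointPair.algebraMap c⟩

/-- The algebra `L(E)` of adjointable operators on a right Hilbert `A`-module `E`, with
composition as product, the operator norm, and the adjoint as involution. -/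
def Adjointable : Type _ := adjointableSubalgebra A E

namespace Adjointable

noncomputable instance : NormedRing (Adjointable A E) :=
  inferInstanceAs (NormedRing (adjointableSubalgebra A E))

noncomputable instance : NormedAlgebra ℂ (Adjointable A E) :=
  inferInstanceAs (NormedAlgebra ℂ (adjointableSubalgebra A E))

variable {A E}

/-- The underlying bounded operator. -/
def toCLM (T : Adjointable A E) : E →L[ℂ] E := T.1

instance : CoeFun (Adjointable A E) (fun _ => E → E) := ⟨fun T => T.toCLM⟩

theorem toCLM_injective {T S : Adjointable A E} (h : T.toCLM = S.toCLM) : T = S := Subtype.ext h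

@[simp] theorem toCLM_add (T S : Adjointable A E) : (T + S).toCLM = T.toCLM + S.toCLM := rfl

@[simp] theorem toCLM_mul (T S : Adjointable A E) : (T * S).toCLM = T.toCLM * S.toCLM := rfl

@[simp] theorem toCLM_smul (c : ℂ) (T : Adjointable A E) : (c • T).toCLM = c • T.toCLM := rfl

theorem norm_def (T : Adjointable A E) : ‖T‖ = ‖T.toCLM‖ := rfl

noncomputable instance : Star (Adjointable A E) where
  star T := ⟨T.2.choose, T.toCLM, T.2.choose_spec.symm⟩

theorem star_spec (T : Adjointable A E) : IsAdjointPair A T.toCLM (star T).toCLM :=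
  T.2.choose_spec

theorem star_eq {T S : Adjointable A E} (h : IsAdjointPair A T.toCLM S.toCLM) : star T = S :=
  toCLM_injective ((star_spec T).unique h)

noncomputable instance : StarRing (Adjointable A E) where
  star_involutive T := star_eq (star_spec T).symm
  star_mul T S := star_eq ((star_spec T).mul (star_spec S))
  star_add T S := star_eq ((star_spec T).add (star_spec S))

instance : StarModule ℂ (Adjointable A E) where
  star_smul c T := star_eq fun x y => by
    have := star_spec T x y
    simp only [toCLM_smul, smul_apply, rinner_smul_complex, rinner_smul_complex_left, this]

instance : CStarRing (Adjointable A E) where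
  norm_mul_self_le T := by
    have key : ‖T.toCLM‖ ≤ √‖(star T * T).toCLM‖ := by
      refine ContinuousLinearMap.opNorm_le_bound _ (Real.sqrt_nonneg _) fun x => ?_
      have h1 : ‖T x‖ ^ 2 ≤ ‖(star T * T).toCLM‖ * ‖x‖ ^ 2 := by
        rw [norm_sq_rinner A, star_spec T]
        refine (norm_rinner_le A _ _).trans ?_
        calc ‖x‖ * ‖(star T * T).toCLM x‖
            ≤ ‖x‖ * (‖(star T * T).toCLM‖ * ‖x‖) := by
              gcongr; exact ContinuousLinearMap.le_opNorm _ _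
          _ = _ := by ring
      refine (Real.le_sqrt_of_sq_le h1).trans_eq ?_
      rw [Real.sqrt_mul (norm_nonneg _), Real.sqrt_sq (norm_nonneg _)]
    have h2 := mul_self_le_mul_self (norm_nonneg _) key
    rwa [Real.mul_self_sqrt (norm_nonneg _)] at h2

end Adjointable

/-- The "compact" operators `K(E)`: the closed linear span in `L(E)` of the operators
`z ↦ x · ⟨y, z⟩`, for `x y : E`. -/
noncomputable def compacts : Submodule ℂ (Adjointable A E) :=
  (Submodule.span ℂ {T : Adjointable A E |
    ∃ x y : E, ∀ z : E, T z = op (rinner A y z) • x}).topologicalClosure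

/-- `E` is countably generated: for some sequence `g`, the linear span of the elements
`g n · a` is dense. -/
def IsCountablyGenerated : Prop :=
  ∃ g : ℕ → E, Dense (Submodule.span ℂ {z : E | ∃ (n : ℕ) (a : A), z = op a • g n} : Set E)

variable {E}

/-- A (Hilbert) submodule of a right Hilbert `A`-module: a closed subspace, invariant under the
right action of `A`, with the restricted inner product. -/
structure IsHilbertSubmodule (M : Submodule ℂ E) : Prop where
  isClosed : IsClosed (M : Set E)
  smul_mem : ∀ (a : A), ∀ x ∈ M, op a • x ∈ M

/-- `M ⊂⊂ E`: some self-adjoint "compact" operator on `E` restricts to the identity on the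
Hilbert submodule `M`. -/
def IsCompactlyContained (M : Submodule ℂ E) : Prop :=
  IsHilbertSubmodule A M ∧
    ∃ T ∈ compacts A E, IsSelfAdjoint T ∧ ∀ x ∈ M, T x = x

/-- The Hilbert submodule `M` of `E` is isomorphic to `E` as a Hilbert `A`-module: there is an
`A`-linear bijection preserving the `A`-valued inner products. -/
def IsIsomorphicToWhole (M : Submodule ℂ E) : Prop :=
  ∃ u : M ≃ₗ[ℂ] E,
    (∀ (a : A) (x y : M), (y : E) = op a • (x : E) → u y = op a • u x) ∧
    ∀ x y : M, rinner A (u x) (u y) = rinner A (x : E) (y : E)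

end Basic

/-- A scaling element of a `⋆`-algebra. -/
def IsScalingElement {B : Type*} [Mul B] [Star B] (x : B) : Prop :=
  (star x * x) * (x * star x) = x * star x ∧ star x * x ≠ x * star x

/-- An infinite projection: one that is Murray-von Neumann equivalent to a proper
subprojection. -/
def IsInfiniteProjection {B : Type*} [Mul B] [Star B] (p : B) : Prop :=
  IsStarProjection p ∧
    ∃ v : B, star v * v = p ∧ p * (v * star v) = v * star v ∧ v * star v ≠ p

/-- No matrix algebra `M_n(B)` contains an infinite projection. -/
def NoInfiniteProjections (B : Type*) [NonUnitalCStarAlgebra B] : Prop :=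
  ∀ (n : ℕ) (p : CStarMatrix (Fin n) (Fin n) B), ¬ IsInfiniteProjection p

/-- `A` has a multiplicative identity. -/
def HasIdentity (A : Type*) [NonUnitalCStarAlgebra A] : Prop :=
  ∃ e : A, ∀ a : A, e * a = a ∧ a * e = a

/-- Stable finiteness: for unital `A`, no `M_n(A)` contains an infinite projection; a nonunital
`A` is stably finite if its unitization is. -/
def IsStablyFinite (A : Type*) [NonUnitalCStarAlgebra A] : Prop :=
  (HasIdentity A → NoInfiniteProjections A) ∧
    (¬ HasIdentity A → NoInfiniteProjections (Unitization ℂ A))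

section Stabilization

variable (A : Type*) [NonUnitalCStarAlgebra A] [PartialOrder A] [StarOrderedRing A]

variable {A} in
theorem summable_of_nonneg_of_le' {f g : ℕ → A} (hf : ∀ i, 0 ≤ f i) (hfg : ∀ i, f i ≤ g i)
    (hg : Summable g) : Summable f := by
  rw [summable_iff_vanishing_norm] at hg ⊢
  intro ε hε
  obtain ⟨s, hs⟩ := hg ε hε
  refine ⟨s, fun t ht => lt_of_le_of_lt ?_ (hs t ht)⟩
  exact CStarAlgebra.norm_le_norm_of_nonneg_of_le (Finset.sum_nonneg fun i _ => hf i)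
    (Finset.sum_le_sum fun i _ => hfg i)

/-- The sequences `ξ` in `A` for which `∑ (ξ i)⋆ (ξ i)` converges in norm. -/
def sqSummable : Submodule ℂ (ℕ → A) where
  carrier := {ξ | Summable fun i => star (ξ i) * ξ i}
  zero_mem' := by simp
  add_mem' := by
    intro ξ η hξ hη
    refine summable_of_nonneg_of_le' (fun i => star_mul_self_nonneg _) (fun i => ?_)
      ((hξ.add hξ).add (hη.add hη))
    have h := star_mul_self_nonneg (ξ i - η i)
    rw [← sub_nonneg]
    convert h using 1
    simp only [Pi.add_apply, star_add, star_sub]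
    noncomm_ring
  smul_mem' := by
    intro c ξ hξ
    refine (Summable.const_smul (star c * c) hξ).congr fun i => ?_
    simp [smul_mul_smul_comm]

/-- The standard right Hilbert `A`-module `ℓ²(A) = A ⊗ ℓ²(ℕ)`. -/
def StdModule : Type _ := sqSummable A

namespace StdModule

variable {A}

noncomputable instance : AddCommGroup (StdModule A) := inferInstanceAs (AddCommGroup (sqSummable A))

noncomputable instance : Module ℂ (StdModule A) := inferInstanceAs (Module ℂ (sqSummable A))

instance : CoeFun (StdModule A) (fun _ => ℕ → A) := ⟨fun ξ => ξ.1⟩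

@[ext] theorem ext {ξ η : StdModule A} (h : ∀ i, ξ i = η i) : ξ = η := Subtype.ext (funext h)

@[simp] theorem add_apply (ξ η : StdModule A) (i : ℕ) : (ξ + η) i = ξ i + η i := rfl

@[simp] theorem smul_apply (c : ℂ) (ξ : StdModule A) (i : ℕ) : (c • ξ) i = c • ξ i := rfl

@[simp] theorem zero_apply (i : ℕ) : (0 : StdModule A) i = 0 := rfl

theorem summable_self (ξ : StdModule A) : Summable fun i => star (ξ i) * ξ i := ξ.2

theorem summable_inner (ξ η : StdModule A) : Summable fun i => star (ξ i) * η i := by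
  have h1 := ((summable_self (ξ + η)).sub (summable_self ξ)).sub (summable_self η)
  have h2 := ((summable_self (ξ + Complex.I • η)).sub (summable_self ξ)).sub (summable_self η)
  have h3 := (h1.sub (h2.const_smul Complex.I)).const_smul ((1 / 2 : ℂ))
  refine h3.congr fun i => ?_
  simp only [add_apply, smul_apply, star_add, star_smul, add_mul, mul_add, smul_mul_assoc,
    mul_smul_comm, smul_smul, smul_sub, smul_add]
  simp only [RCLike.star_def, Complex.conj_I, mul_neg, Complex.I_mul_I]
  module

/-- The right action of `A`, by coordinatewise right multiplication. -/
noncomputable instance : SMul Aᵐᵒᵖ (StdModule A) where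
  smul a ξ := ⟨fun i => ξ i * unop a, by
    refine ((ξ.2.mul_left (star (unop a))).mul_right (unop a)).congr fun i => ?_
    simp [mul_assoc]⟩

@[simp] theorem op_smul_apply (a : Aᵐᵒᵖ) (ξ : StdModule A) (i : ℕ) :
    (a • ξ) i = ξ i * unop a := rfl

/-- The inner product `⟨ξ, η⟩ = ∑ (ξ i)⋆ (η i)` of `ℓ²(A)`. -/
noncomputable instance : Inner Aᵐᵒᵖ (StdModule A) where
  inner ξ η := op (∑' i, star (ξ i) * η i)

theorem inner_def (ξ η : StdModule A) : inner Aᵐᵒᵖ ξ η = op (∑' i, star (ξ i) * η i) := rfl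

noncomputable instance : Norm (StdModule A) := CStarModule.norm Aᵐᵒᵖ

noncomputable instance : CStarModule Aᵐᵒᵖ (StdModule A) where
  inner_add_right {ξ η ζ} := by
    simp only [inner_def, add_apply, mul_add]
    rw [(summable_inner ξ η).tsum_add (summable_inner ξ ζ), op_add]
  inner_self_nonneg {ξ} := by
    change (0 : A) ≤ ∑' i, star (ξ i) * ξ i
    exact tsum_nonneg fun i => star_mul_self_nonneg _
  inner_self {ξ} := by
    constructor
    · intro h
      have h' : HasSum (fun i => star (ξ i) * ξ i) 0 := by
        have := ξ.2.hasSum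
        rwa [show ∑' i, star (ξ i) * ξ i = 0 from op_injective h] at this
      rw [hasSum_zero_iff_of_nonneg fun i => star_mul_self_nonneg _] at h'
      ext i
      simpa [CStarRing.star_mul_self_eq_zero_iff] using congrFun h' i
    · rintro rfl
      simp [inner_def]
  inner_op_smul_right {a ξ η} := by
    apply unop_injective
    simp only [inner_def, op_smul_apply, unop_op, unop_mul, ← mul_assoc]
    exact (summable_inner ξ η).tsum_mul_right _
  inner_smul_right_complex {c ξ η} := by
    simp only [inner_def, smul_apply, mul_smul_comm]
    rw [(summable_inner ξ η).tsum_const_smul, op_smul]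
  star_inner ξ η := by
    apply unop_injective
    simp only [inner_def, ← op_star, unop_op, tsum_star, star_mul, star_star]
  norm_eq_sqrt_norm_inner_self ξ := rfl

noncomputable instance : NormedAddCommGroup (StdModule A) :=
  NormedAddCommGroup.ofCore (CStarModule.normedSpaceCore Aᵐᵒᵖ)

noncomputable instance : NormedSpace ℂ (StdModule A) :=
  NormedSpace.ofCore (CStarModule.normedSpaceCore Aᵐᵒᵖ)

/-- The elementary tensor `b ⊗ v` of `ℓ²(A) = A ⊗ ℓ²(ℕ)`. -/
noncomputable def tmul (b : A) (v : lp (fun _ : ℕ => ℂ) 2) : StdModule A :=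
  ⟨fun i => v i • b, by
    have hv : Summable fun i => ((‖v i‖ ^ 2 : ℝ) : ℂ) := by
      have := (lp.memℓp v).summable (by norm_num)
      exact_mod_cast (by simpa using this : Summable fun i => ‖v i‖ ^ 2)
    refine (hv.smul_const (star b * b)).congr fun i => ?_
    simp only [star_smul, smul_mul_smul_comm, RCLike.star_def]
    rw [Complex.conj_mul']
    push_cast
    rfl⟩

end StdModule

/-- `A ⊗ K`, where `K` is the algebra of compact operators on `ℓ²(ℕ)`: the C⋆-subalgebra of
`L(A ⊗ ℓ²(ℕ))` generated by the operators `a ⊗ k : b ⊗ v ↦ a b ⊗ k v`, for `a` in `A` and `k` a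
compact operator on `ℓ²(ℕ)`. -/
noncomputable def stabilization : NonUnitalStarSubalgebra ℂ (Adjointable A (StdModule A)) :=
  (NonUnitalStarAlgebra.adjoin ℂ {T : Adjointable A (StdModule A) |
    ∃ (a : A) (k : lp (fun _ : ℕ => ℂ) 2 →L[ℂ] lp (fun _ : ℕ => ℂ) 2), IsCompactOperator k ∧
      ∀ (b : A) (v : lp (fun _ : ℕ => ℂ) 2),
        T (StdModule.tmul b v) = StdModule.tmul (a * b) (k v)}).topologicalClosure

/-- `A ⊗ K` contains a scaling element. -/
def StabilizationHasScalingElement : Prop := ∃ x : stabilization A, IsScalingElement x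

end Stabilization

end HilbertMod

/-!
Write `L(E)` and `K(E)` for the adjointable and the "compact" operators on a Hilbert module `E`,
and `H` for the standard module `ℓ²(A)`. Maps that preserve inner products are not assumed to have
adjoints.

**A scaling element from `E ≅ F`.** The isomorphism gives a map `v : F → F` with range `E` that
preserves inner products, and the hypothesis a self-adjoint `T ∈ K(F)` with `T v = v`. Since `F` is
countably generated, there is an adjointable map `B : H → F` with dense range, and sending `B ξ` to
`(B⋆ B)^{1/2} ξ` defines an inner product preserving embedding `V : F → H`
(`IsCountablyGenerated.exists_preservesRinner`). Although `v` and `V` need not be adjointable, the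
operator `X = V v T V⋆` makes sense as an element of `K(H) ⊆ A ⊗ K`: this is clear for finite rank
operators in place of `T`, and the correspondence is contractive (`exists_isTransfer`). From
`T v = v` one finds `X⋆ X X X⋆ = X X⋆`, and `X⋆ X = X X⋆` forces `T² F ⊆ E` and `T F = F`, hence
`E = F` (`IsTransfer.scaling`).

**No scaling element if `A` is stably finite.** If `x` is a scaling element of a unital C⋆-algebra
and `h = x⋆ x`, then `(1 - h) x = 0`, and `v = (2 x + 1 - h) (1 + h)⁻¹` is an isometry that is not
unitary (`IsScalingElement.star_mul_scalingIsometry`,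
`IsScalingElement.scalingIsometry_mul_star_ne`). This element depends continuously on `x`. Finite
matrices over `A` are dense in `A ⊗ K` (`stabilization_le_closure`), so that `v` is approximated by
elements of the unitization of some `M_n(A)`. That unitization sits injectively, thus
isometrically, in `L(H)`, and the polar decomposition of an approximant is an isometry in it; were
it unitary, `v` would be close to an invertible element and so would be invertible itself
(`exists_nonunitary_isometry`). A non-unitary isometry in the unitization of `M_n(A)` yields one
in `M_n(A)`, or in `M_n` of the unitization of `A`, and hence an infinite projection there
(`IsStablyFinite.mul_star_eq_one`).
-/

namespace HilbertMod

open MulOpposite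

set_option linter.unusedSectionVars false

/-! ### Right Hilbert modules -/

section General

variable {A : Type*} [NonUnitalCStarAlgebra A] [PartialOrder A] [StarOrderedRing A]
variable {E : Type*} [NormedAddCommGroup E] [NormedSpace ℂ E] [SMul Aᵐᵒᵖ E] [CStarModule Aᵐᵒᵖ E]
variable {F : Type*} [NormedAddCommGroup F] [NormedSpace ℂ F] [SMul Aᵐᵒᵖ F] [CStarModule Aᵐᵒᵖ F]
variable {G : Type*} [NormedAddCommGroup G] [NormedSpace ℂ G] [SMul Aᵐᵒᵖ G] [CStarModule Aᵐᵒᵖ G]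

theorem rinner_smul_left (a : A) (x y : E) : rinner A (op a • x) y = star a * rinner A x y := by
  rw [← rinner_star, rinner_smul_right, star_mul, rinner_star]

theorem rinner_sub_right (x y z : E) : rinner A x (y - z) = rinner A x y - rinner A x z := by
  simp [rinner]

theorem rinner_neg_right (x y : E) : rinner A x (-y) = -rinner A x y := by
  simp [rinner]

theorem rinner_sum_right {ι : Type*} (s : Finset ι) (x : E) (y : ι → E) :
    rinner A x (∑ i ∈ s, y i) = ∑ i ∈ s, rinner A x (y i) := by
  simp [rinner, CStarModule.inner_sum_right]

theorem rinner_sum_left {ι : Type*} (s : Finset ι) (x : ι → E) (y : E) :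
    rinner A (∑ i ∈ s, x i) y = ∑ i ∈ s, rinner A (x i) y := by
  simp [rinner, CStarModule.inner_sum_left]

theorem rinner_self_nonneg (x : E) : 0 ≤ rinner A x x :=
  CStarModule.inner_self_nonneg (A := Aᵐᵒᵖ)

variable (A) in
theorem rinner_self_eq_zero {x : E} : rinner A x x = 0 ↔ x = 0 := by
  rw [← norm_eq_zero, ← norm_sq_rinner, sq_eq_zero_iff, norm_eq_zero]

/-- A `CStarModule` carries the bare right action: its additivity, like the other module axioms,
follows from the properties of the inner product. -/
theorem op_add_smul (a b : A) (x : E) : op (a + b) • x = op a • x + op b • x :=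
  ext_rinner A fun z => by simp only [rinner_smul_left, rinner_add_left, star_add, add_mul]

theorem op_smul_add (a : A) (x y : E) : op a • (x + y) = op a • x + op a • y :=
  ext_rinner A fun z => by simp only [rinner_smul_left, rinner_add_left, mul_add]

theorem op_smul_complex (a : A) (c : ℂ) (x : E) : op a • c • x = c • op a • x :=
  ext_rinner A fun z => by
    simp only [rinner_smul_left, rinner_smul_complex_left, mul_smul_comm]

theorem op_complex_smul (a : A) (c : ℂ) (x : E) : op (c • a) • x = c • op a • x :=
  ext_rinner A fun z => by
    simp only [rinner_smul_left, rinner_smul_complex_left, star_smul, smul_mul_assoc]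

theorem norm_op_smul_le (a : A) (x : E) : ‖op a • x‖ ≤ ‖x‖ * ‖a‖ := by
  refine le_of_sq_le_sq ?_ (by positivity)
  rw [norm_sq_rinner A, rinner_smul_left, rinner_smul_right]
  calc ‖star a * (rinner A x x * a)‖ ≤ ‖star a‖ * (‖rinner A x x‖ * ‖a‖) :=
        (norm_mul_le _ _).trans (by gcongr; exact norm_mul_le _ _)
    _ = (‖x‖ * ‖a‖) ^ 2 := by rw [norm_star, ← norm_sq_rinner]; ring

theorem norm_eq_of_rinner_eq {x : E} {y : F} (h : rinner A x x = rinner A y y) : ‖x‖ = ‖y‖ := by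
  rw [← sq_eq_sq₀ (norm_nonneg _) (norm_nonneg _), norm_sq_rinner A, norm_sq_rinner A, h]

variable (A E) in
/-- The right action as a continuous bilinear map. -/
noncomputable def opSMulL : E →L[ℂ] A →L[ℂ] E :=
  LinearMap.mkContinuous₂ (LinearMap.mk₂ ℂ (fun (x : E) (a : A) => op a • x)
    (fun x y a => op_smul_add a x y) (fun c x a => op_smul_complex a c x)
    (fun x a b => op_add_smul a b x) (fun c x a => op_complex_smul a c x)) 1
    (fun x a => by simpa using norm_op_smul_le a x)

@[simp] theorem opSMulL_apply (x : E) (a : A) : opSMulL A E x a = op a • x := rfl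

variable (A) in
/-- The `A`-valued inner product against a fixed left vector, as a continuous linear map. -/
noncomputable def rinnerL (x : E) : E →L[ℂ] A :=
  LinearMap.mkContinuous
    { toFun := fun y => rinner A x y
      map_add' := rinner_add_right A x
      map_smul' := fun c y => rinner_smul_complex A c x y } ‖x‖ (fun y => norm_rinner_le A x y)

@[simp] theorem rinnerL_apply (x y : E) : rinnerL A x y = rinner A x y := rfl

theorem continuous_rinner : Continuous fun p : E × E => rinner A p.1 p.2 := by
  let B : E →ₗ⋆[ℂ] E →ₗ[ℂ] A := LinearMap.mk₂'ₛₗ (starRingEnd ℂ) (RingHom.id ℂ) (rinner A)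
    (rinner_add_left A) (fun c x y => rinner_smul_complex_left A c x y) (rinner_add_right A)
    (fun c x y => rinner_smul_complex A c x y)
  let B' := B.mkContinuous₂ 1 (fun x y => by
    rw [one_mul]; exact norm_rinner_le A x y)
  exact (B'.continuous.comp continuous_fst).clm_apply continuous_snd

/-- A complex-linear map that preserves the `A`-valued inner products. It is automatically
isometric and `A`-linear, but need not be adjointable. -/
def PreservesRinner (A : Type*) [NonUnitalCStarAlgebra A] [PartialOrder A] [StarOrderedRing A]
    {E F : Type*} [NormedAddCommGroup E] [NormedSpace ℂ E] [SMul Aᵐᵒᵖ E] [CStarModule Aᵐᵒᵖ E]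
    [NormedAddCommGroup F] [NormedSpace ℂ F] [SMul Aᵐᵒᵖ F] [CStarModule Aᵐᵒᵖ F]
    (V : E →ₗ[ℂ] F) : Prop :=
  ∀ x y, rinner A (V x) (V y) = rinner A x y

namespace PreservesRinner

theorem comp {V : F →ₗ[ℂ] G} {U : E →ₗ[ℂ] F} (hV : PreservesRinner A V)
    (hU : PreservesRinner A U) : PreservesRinner A (V ∘ₗ U) := fun x y =>
  (hV _ _).trans (hU x y)

variable {V : E →ₗ[ℂ] F} (hV : PreservesRinner A V)
include hV

theorem norm_map (x : E) : ‖V x‖ = ‖x‖ := norm_eq_of_rinner_eq (hV x x)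

theorem isometry : Isometry V := AddMonoidHomClass.isometry_of_norm V hV.norm_map

theorem map_op_smul (a : A) (x : E) : V (op a • x) = op a • V x := by
  rw [← sub_eq_zero, ← rinner_self_eq_zero A]
  simp only [rinner_sub_left, rinner_sub_right, rinner_smul_left, rinner_smul_right, hV _ _]
  simp [mul_assoc]

theorem isClosed_range [CompleteSpace E] : IsClosed (Set.range V) :=
  hV.isometry.isClosedEmbedding.isClosed_range

end PreservesRinner

namespace Adjointable

theorem rinner_apply_left (T : Adjointable A E) (x y : E) :
    rinner A (T x) y = rinner A x (star T y) := star_spec T x y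

theorem rinner_apply_right (T : Adjointable A E) (x y : E) :
    rinner A x (T y) = rinner A (star T x) y := by
  rw [rinner_apply_left, star_star]

@[simp] theorem mul_apply (T S : Adjointable A E) (x : E) : (T * S) x = T (S x) := rfl

@[simp] theorem add_apply (T S : Adjointable A E) (x : E) : (T + S) x = T x + S x := rfl

@[simp] theorem neg_apply (T : Adjointable A E) (x : E) : (-T) x = -T x := rfl

@[simp] theorem sub_apply (T S : Adjointable A E) (x : E) : (T - S) x = T x - S x := rfl

@[simp] theorem smul_apply (c : ℂ) (T : Adjointable A E) (x : E) : (c • T) x = c • T x := rfl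

@[simp] theorem one_apply (x : E) : (1 : Adjointable A E) x = x := rfl

@[simp] theorem zero_apply (x : E) : (0 : Adjointable A E) x = 0 := rfl

@[ext] theorem ext {T S : Adjointable A E} (h : ∀ x, T x = S x) : T = S :=
  toCLM_injective (ContinuousLinearMap.ext h)

theorem le_norm (T : Adjointable A E) (x : E) : ‖T x‖ ≤ ‖T‖ * ‖x‖ := T.toCLM.le_opNorm x

theorem norm_le (T : Adjointable A E) {M : ℝ} (hM : 0 ≤ M) (h : ∀ x, ‖T x‖ ≤ M * ‖x‖) :
    ‖T‖ ≤ M := T.toCLM.opNorm_le_bound hM h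

theorem map_op_smul (T : Adjointable A E) (a : A) (x : E) : T (op a • x) = op a • T x :=
  ext_rinner A fun z => by
    rw [rinner_apply_left, rinner_smul_left, rinner_smul_left, rinner_apply_left]

/-- Evaluation at a vector. -/
noncomputable def applyL (x : E) : Adjointable A E →L[ℂ] E :=
  (ContinuousLinearMap.apply ℂ E x).comp (adjointableSubalgebra A E).toSubmodule.subtypeL

theorem finsetSum_apply {ι : Type*} (s : Finset ι) (T : ι → Adjointable A E) (x : E) :
    (∑ i ∈ s, T i) x = ∑ i ∈ s, T i x := map_sum (applyL x) T s

instance [CompleteSpace E] : CompleteSpace (Adjointable A E) := by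
  refine Metric.complete_of_cauchySeq_tendsto fun u hu => ?_
  have hiso : Isometry (toCLM : Adjointable A E → E →L[ℂ] E) := isometry_subtype_coe
  have hstar : Isometry (star : Adjointable A E → Adjointable A E) := star_isometry
  obtain ⟨T, hT⟩ := cauchySeq_tendsto_of_complete (hiso.uniformContinuous.comp_cauchySeq hu)
  obtain ⟨S, hS⟩ := cauchySeq_tendsto_of_complete
    ((hiso.comp hstar).uniformContinuous.comp_cauchySeq hu)
  have hTS : IsAdjointPair A T S := by
    intro x y
    have h1 := (continuous_rinner (A := A)).tendsto (T x, y) |>.comp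
      (((ContinuousLinearMap.apply ℂ E x).continuous.tendsto T |>.comp hT).prodMk_nhds
        tendsto_const_nhds)
    have h2 := (continuous_rinner (A := A)).tendsto (x, S y) |>.comp
      (Filter.Tendsto.prodMk_nhds tendsto_const_nhds
        ((ContinuousLinearMap.apply ℂ E y).continuous.tendsto S |>.comp hS))
    exact tendsto_nhds_unique h1 (h2.congr fun n => (star_spec (u n) x y).symm)
  exact ⟨⟨T, S, hTS⟩, hiso.isEmbedding.isInducing.tendsto_nhds_iff.2 hT⟩

noncomputable instance [CompleteSpace E] : CStarAlgebra (Adjointable A E) where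

theorem continuous_toCLM_apply (x : E) : Continuous fun T : Adjointable A E => T x :=
  (applyL x).continuous

/-- The operator `z ↦ x · ⟨y, z⟩`. -/
noncomputable def rankOne (x y : E) : Adjointable A E :=
  ⟨(opSMulL A E x).comp (rinnerL A y), (opSMulL A E y).comp (rinnerL A x), fun z w => by
    simp [rinner_smul_left, rinner_smul_right, rinner_star]⟩

@[simp] theorem rankOne_apply (x y z : E) :
    (rankOne x y : Adjointable A E) z = op (rinner A y z) • x := rfl

theorem star_rankOne (x y : E) : star (rankOne x y : Adjointable A E) = rankOne y x :=
  star_eq fun z w => by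
    change rinner A (op (rinner A y z) • x) w = rinner A z (op (rinner A x w) • y)
    simp [rinner_smul_left, rinner_smul_right, rinner_star]

theorem norm_rankOne_le (x y : E) : ‖(rankOne x y : Adjointable A E)‖ ≤ ‖x‖ * ‖y‖ :=
  norm_le _ (by positivity) fun z => by
    rw [rankOne_apply, mul_assoc]
    exact (norm_op_smul_le _ _).trans (by gcongr; exact norm_rinner_le A y z)

theorem rankOne_add_right (x y y' : E) :
    (rankOne x (y + y') : Adjointable A E) = rankOne x y + rankOne x y' := by
  ext z; simp only [rankOne_apply, rinner_add_left, op_add_smul, add_apply]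

theorem compacts_le_of_rankOne {p : Submodule ℂ (Adjointable A E)}
    (hp : IsClosed (p : Set (Adjointable A E))) (h : ∀ x y, rankOne x y ∈ p) :
    compacts A E ≤ p := by
  refine Submodule.topologicalClosure_minimal _ (Submodule.span_le.2 ?_) hp
  rintro T ⟨x, y, hT⟩
  rw [show T = rankOne x y from ext hT]
  exact h x y

end Adjointable

end General

/-! ### The standard module `ℓ²(A)` -/

namespace StdModule

variable {A : Type*} [NonUnitalCStarAlgebra A] [PartialOrder A] [StarOrderedRing A]

@[simp] theorem sub_apply (ξ η : StdModule A) (i : ℕ) : (ξ - η) i = ξ i - η i := rfl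

@[simp] theorem sum_apply {ι : Type*} (s : Finset ι) (ξ : ι → StdModule A) (i : ℕ) :
    (∑ j ∈ s, ξ j) i = ∑ j ∈ s, ξ j i := by
  classical
  induction s using Finset.induction_on with
  | empty => simp
  | insert j s hj ih => rw [Finset.sum_insert hj, Finset.sum_insert hj, add_apply, ih]

theorem rinner_eq_tsum (ξ η : StdModule A) : rinner A ξ η = ∑' i, star (ξ i) * η i := rfl

theorem star_mul_self_le_rinner (ξ : StdModule A) (i : ℕ) :
    star (ξ i) * ξ i ≤ rinner A ξ ξ :=
  (summable_self ξ).le_tsum i fun _ _ => star_mul_self_nonneg _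

theorem norm_apply_le (ξ : StdModule A) (i : ℕ) : ‖ξ i‖ ≤ ‖ξ‖ := by
  refine le_of_sq_le_sq ?_ (norm_nonneg _)
  rw [sq, ← CStarRing.norm_star_mul_self, norm_sq_rinner A]
  exact CStarAlgebra.norm_le_norm_of_nonneg_of_le (star_mul_self_nonneg _)
    (star_mul_self_le_rinner ξ i)

/-- The coordinate maps of `ℓ²(A)`. -/
noncomputable def coordL (i : ℕ) : StdModule A →L[ℂ] A :=
  LinearMap.mkContinuous
    { toFun := fun ξ => ξ i
      map_add' := fun _ _ => rfl
      map_smul' := fun _ _ => rfl } 1 fun ξ => (norm_apply_le ξ i).trans_eq (one_mul _).symm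

/-- The sequence with entry `a` at place `i` and zero elsewhere. -/
noncomputable def single (i : ℕ) (a : A) : StdModule A :=
  ⟨Pi.single i a, summable_of_ne_finset_zero (s := {i}) fun j hj => by
    simp [Pi.single_eq_of_ne (Finset.notMem_singleton.1 hj)]⟩

theorem single_apply (i : ℕ) (a : A) (j : ℕ) : single i a j = if j = i then a else 0 :=
  Pi.single_apply i a j

@[simp] theorem single_apply_self (i : ℕ) (a : A) : single i a i = a := by simp [single_apply]

theorem rinner_single_left (i : ℕ) (a : A) (ξ : StdModule A) :
    rinner A (single i a) ξ = star a * ξ i := by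
  rw [rinner_eq_tsum, tsum_eq_single i fun j hj => by simp [single_apply, hj], single_apply_self]

theorem rinner_single_right (i : ℕ) (a : A) (ξ : StdModule A) :
    rinner A ξ (single i a) = star (ξ i) * a := by
  rw [← rinner_star, rinner_single_left, star_mul, star_star]

theorem norm_single (i : ℕ) (a : A) : ‖single i a‖ = ‖a‖ := by
  rw [← sq_eq_sq₀ (norm_nonneg _) (norm_nonneg _), norm_sq_rinner A, rinner_single_left,
    single_apply_self, CStarRing.norm_star_mul_self, sq]

theorem op_smul_single (a b : A) (i : ℕ) : op b • single i a = single i (a * b) := by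
  ext j; by_cases h : j = i <;> simp [single_apply, h]

/-- `single i` as a linear map. -/
noncomputable def singleₗ (i : ℕ) : A →ₗ[ℂ] StdModule A where
  toFun := single i
  map_add' a b := by ext j; by_cases h : j = i <;> simp [single_apply, h]
  map_smul' c a := by ext j; by_cases h : j = i <;> simp [single_apply, h]

@[simp] theorem singleₗ_apply (i : ℕ) (a : A) : singleₗ i a = single i a := rfl

/-- The truncation of a sequence to a finite set of places. -/
noncomputable def trunc (s : Finset ℕ) (ξ : StdModule A) : StdModule A := ∑ i ∈ s, single i (ξ i)

theorem trunc_apply (s : Finset ℕ) (ξ : StdModule A) (i : ℕ) :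
    trunc s ξ i = if i ∈ s then ξ i else 0 := by
  simp [trunc, single_apply]

theorem rinner_trunc (s : Finset ℕ) (ξ : StdModule A) :
    rinner A (trunc s ξ) (trunc s ξ) = ∑ i ∈ s, star (ξ i) * ξ i := by
  rw [rinner_eq_tsum, tsum_eq_sum (s := s) fun i hi => by simp [trunc_apply, hi]]
  exact Finset.sum_congr rfl fun i hi => by simp [trunc_apply, hi]

theorem norm_trunc_le (s : Finset ℕ) (ξ : StdModule A) : ‖trunc s ξ‖ ≤ ‖ξ‖ := by
  refine le_of_sq_le_sq ?_ (norm_nonneg _)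
  rw [norm_sq_rinner A, norm_sq_rinner A, rinner_trunc]
  exact CStarAlgebra.norm_le_norm_of_nonneg_of_le
    (Finset.sum_nonneg fun _ _ => star_mul_self_nonneg _)
    ((summable_self ξ).sum_le_tsum s fun _ _ => star_mul_self_nonneg _)

/-- Finite truncations of an element of `ℓ²(A)` converge to it. -/
theorem tendsto_trunc (ξ : StdModule A) :
    Filter.Tendsto (fun s => trunc s ξ) Filter.atTop (nhds ξ) := by
  have h := (summable_self ξ).hasSum
  have h1 : ∀ s, ‖trunc s ξ - ξ‖ ^ 2 =
      ‖(∑ i ∈ s, star (ξ i) * ξ i) - ∑' i, star (ξ i) * ξ i‖ := by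
    intro s
    have h2 : rinner A (trunc s ξ) ξ = ∑ i ∈ s, star (ξ i) * ξ i := by
      simp [trunc, rinner_sum_left, rinner_single_left]
    have h3 : rinner A ξ (trunc s ξ) = ∑ i ∈ s, star (ξ i) * ξ i := by
      simp [trunc, rinner_sum_right, rinner_single_right]
    rw [norm_sq_rinner A, rinner_sub_left, rinner_sub_right, rinner_sub_right, rinner_trunc,
      h2, h3, sub_self, zero_sub, norm_neg, ← rinner_eq_tsum, norm_sub_rev]
  rw [tendsto_iff_norm_sub_tendsto_zero]
  have h4 := (tendsto_iff_norm_sub_tendsto_zero.1 h).sqrt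
  simpa [← h1, Real.sqrt_sq] using h4

/-- `ℓ²(A)` is complete: the coordinatewise limit of a Cauchy sequence is its limit in norm. -/
instance : CompleteSpace (StdModule A) := by
  refine Metric.complete_of_cauchySeq_tendsto fun u hu => ?_
  have hc : ∀ i, ∃ a, Filter.Tendsto (fun n => u n i) Filter.atTop (nhds a) := fun i =>
    cauchySeq_tendsto_of_complete ((coordL i).uniformContinuous.comp_cauchySeq hu)
  choose ξ hξ using hc
  -- the finite sections of `ξ - u n` are small, uniformly in the section
  have key : ∀ ε > 0, ∃ N, ∀ n ≥ N, ∀ s : Finset ℕ,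
      ‖∑ i ∈ s, single i (ξ i - u n i)‖ ≤ ε := by
    intro ε hε
    obtain ⟨N, hN⟩ := Metric.cauchySeq_iff.1 hu ε hε
    refine ⟨N, fun n hn s => ?_⟩
    have ht : Filter.Tendsto (fun m => ∑ i ∈ s, single i (u m i - u n i)) Filter.atTop
        (nhds (∑ i ∈ s, single i (ξ i - u n i))) := by
      refine tendsto_finsetSum s fun i _ => ?_
      have hi : Isometry (singleₗ (A := A) i) := AddMonoidHomClass.isometry_of_norm _ (norm_single i)
      exact (hi.continuous.tendsto _).comp ((hξ i).sub_const _)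
    refine le_of_tendsto ht.norm (Filter.eventually_atTop.2 ⟨N, fun m hm => ?_⟩)
    refine (norm_trunc_le s (u m - u n)).trans ?_
    rw [← dist_eq_norm]
    exact (hN m hm n hn).le
  have hnorm : ∀ (s : Finset ℕ) (f : ℕ → A),
      ‖∑ i ∈ s, star (f i) * f i‖ = ‖∑ i ∈ s, single i (f i)‖ ^ 2 := by
    intro s f
    rw [norm_sq_rinner A, rinner_sum_left]
    congr 1
    refine Finset.sum_congr rfl fun i hi => ?_
    rw [rinner_single_left, sum_apply]
    simp [single_apply, hi]
  have hsum : Summable fun i => star (ξ i) * ξ i := by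
    rw [summable_iff_vanishing_norm]
    intro ε hε
    obtain ⟨N, hN⟩ := key (√ε / 2) (by positivity)
    have h0 : 0 < ε / 4 := by positivity
    obtain ⟨s, hs⟩ := summable_iff_vanishing_norm.1 (summable_self (u N)) (ε / 4) h0
    refine ⟨s, fun t ht => ?_⟩
    have h1 := hs t ht
    have h2 : ‖∑ i ∈ t, single i (u N i)‖ < √ε / 2 := by
      rw [hnorm] at h1
      refine lt_of_pow_lt_pow_left₀ 2 (by positivity) (h1.trans_eq ?_)
      rw [div_pow, Real.sq_sqrt hε.le]; norm_num
    have h3 : ‖∑ i ∈ t, single i (ξ i)‖ < √ε := by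
      have : ∑ i ∈ t, single i (ξ i) =
          ∑ i ∈ t, single i (ξ i - u N i) + ∑ i ∈ t, single i (u N i) := by
        rw [← Finset.sum_add_distrib]
        refine Finset.sum_congr rfl fun i _ => ?_
        simp only [← singleₗ_apply, ← map_add, sub_add_cancel]
      rw [this]
      refine (norm_add_le _ _).trans_lt ?_
      linarith [hN N le_rfl t]
    rw [hnorm]
    calc _ < √ε ^ 2 := by gcongr
      _ = ε := Real.sq_sqrt hε.le
  let Ξ : StdModule A := ⟨ξ, hsum⟩
  refine ⟨Ξ, Metric.tendsto_atTop.2 fun ε hε => ?_⟩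
  obtain ⟨N, hN⟩ := key (ε / 2) (by positivity)
  refine ⟨N, fun n hn => ?_⟩
  rw [dist_comm, dist_eq_norm]
  refine lt_of_le_of_lt (le_of_tendsto (tendsto_trunc (Ξ - u n)).norm
    (Filter.Eventually.of_forall fun s => ?_)) (half_lt_self hε)
  exact hN n hn s

theorem induction_closed {p : StdModule A → Prop} (hp : IsClosed {ξ | p ξ})
    (h : ∀ (s : Finset ℕ) (ξ : StdModule A), p (trunc s ξ)) (ξ : StdModule A) : p ξ :=
  hp.mem_of_tendsto (tendsto_trunc ξ) (Filter.Eventually.of_forall fun s => h s ξ)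

end StdModule

/-! ### Embedding a countably generated module into `ℓ²(A)` -/

section Embedding

variable {A : Type*} [NonUnitalCStarAlgebra A] [PartialOrder A] [StarOrderedRing A]
variable {E : Type*} [NormedAddCommGroup E] [NormedSpace ℂ E] [SMul Aᵐᵒᵖ E] [CStarModule Aᵐᵒᵖ E]
variable {F : Type*} [NormedAddCommGroup F] [NormedSpace ℂ F] [SMul Aᵐᵒᵖ F] [CStarModule Aᵐᵒᵖ F]

/-- A self-adjoint operator on a Hilbert module whose quadratic form is positive has a
self-adjoint square root. The negative part `N` of such an operator satisfies
`⟨N x, Q (N x)⟩ = -⟨N x, N (N x)⟩`, which is both nonnegative and nonpositive. -/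
theorem Adjointable.exists_sqrt_of_rinner_nonneg [CompleteSpace E] {Q : Adjointable A E}
    (hQ : IsSelfAdjoint Q) (h : ∀ x, 0 ≤ rinner A x (Q x)) :
    ∃ R : Adjointable A E, IsSelfAdjoint R ∧ R * R = Q := by
  let _ := CStarAlgebra.spectralOrder (Adjointable A E)
  have _ := CStarAlgebra.spectralOrderedRing (Adjointable A E)
  have hN0 : 0 ≤ Q⁻ := CFC.negPart_nonneg Q
  have hNsa : star (Q⁻) = Q⁻ := (IsSelfAdjoint.of_nonneg hN0).star_eq
  set S := CFC.sqrt (Q⁻) with hS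
  have hSsa : star S = S := (IsSelfAdjoint.of_nonneg (CFC.sqrt_nonneg _)).star_eq
  have hSS : S * S = Q⁻ := CFC.sqrt_mul_sqrt_self _ hN0
  have hQN : Q * Q⁻ = -(Q⁻ * Q⁻) := by
    have h1 : Q * Q⁻ = (Q⁺ - Q⁻) * Q⁻ := by rw [CFC.posPart_sub_negPart Q hQ]
    rw [h1, sub_mul, CFC.posPart_mul_negPart, zero_sub]
  have hSN : S * Q⁻ = 0 := by
    ext x
    have h1 : Q (Q⁻ x) = (-(S * (S * Q⁻))) x := by
      rw [← Adjointable.mul_apply, hQN, ← mul_assoc, hSS]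
    have h2 : rinner A (Q⁻ x) (Q (Q⁻ x)) = -rinner A ((S * Q⁻) x) ((S * Q⁻) x) := by
      rw [h1, Adjointable.neg_apply, rinner_neg_right, Adjointable.mul_apply S,
        Adjointable.rinner_apply_right, hSsa]
      rfl
    have h3 := h (Q⁻ x)
    rw [h2, neg_nonneg] at h3
    exact (rinner_self_eq_zero A).1 (le_antisymm h3 (rinner_self_nonneg _))
  have hN : Q⁻ = 0 := by
    have h2 : star (Q⁻) * Q⁻ = 0 := by rw [hNsa]; nth_rw 1 [← hSS]; rw [mul_assoc, hSN, mul_zero]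
    exact (CStarRing.star_mul_self_eq_zero_iff _).1 h2
  have hQ0 : 0 ≤ Q := (CFC.negPart_eq_zero_iff Q hQ).1 hN
  exact ⟨CFC.sqrt Q, IsSelfAdjoint.of_nonneg (CFC.sqrt_nonneg _), CFC.sqrt_mul_sqrt_self _ hQ0⟩

/-- If some adjointable `B : E → F` has dense range, then `F` embeds in `E` by a map that
preserves inner products, namely the inverse of the partial isometry in the polar
decomposition of `B`: it sends `B x` to `|B| x`. -/
theorem exists_preservesRinner_of_denseRange [CompleteSpace E] {B : E →L[ℂ] F} {W : F →L[ℂ] E}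
    (hBW : ∀ x z, rinner A (B x) z = rinner A x (W z)) (hB : DenseRange B) :
    ∃ V : F →ₗ[ℂ] E, PreservesRinner A V := by
  have hWB : IsAdjointPair A (W.comp B) (W.comp B) := fun x y => by
    rw [ContinuousLinearMap.comp_apply, ContinuousLinearMap.comp_apply, ← hBW, ← rinner_star,
      ← hBW, rinner_star]
  let Q : Adjointable A E := ⟨W.comp B, W.comp B, hWB⟩
  have hQapp : ∀ x y, rinner A x (Q y) = rinner A (B x) (B y) := fun x y => (hBW x (B y)).symm
  obtain ⟨R, hR, hRR⟩ := Adjointable.exists_sqrt_of_rinner_nonneg (Q := Q)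
    (Adjointable.star_eq hWB) fun x => by rw [hQapp]; exact rinner_self_nonneg _
  have hRB : ∀ x y, rinner A (R x) (R y) = rinner A (B x) (B y) := fun x y => by
    rw [← hQapp, ← hRR, Adjointable.rinner_apply_left, hR.star_eq]
    rfl
  let V : F →L[ℂ] E := (R.toCLM : E →ₗ[ℂ] E).extendOfNorm (B : E →ₗ[ℂ] F)
  have hV : ∀ x, V (B x) = R x := fun x =>
    LinearMap.extendOfNorm_eq (f := (R.toCLM : E →ₗ[ℂ] E)) (e := (B : E →ₗ[ℂ] F)) hB
      ⟨1, fun x => by rw [one_mul]; exact (norm_eq_of_rinner_eq (hRB x x)).le⟩ x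
  refine ⟨V, fun x y => ?_⟩
  have hcont := continuous_rinner (A := A) (E := E)
  have hcont' := continuous_rinner (A := A) (E := F)
  refine hB.induction_on₂ (p := fun x y => rinner A (V x) (V y) = rinner A x y) ?_ ?_ x y
  · exact isClosed_eq (hcont.comp (V.continuous.prodMap V.continuous)) hcont'
  · intro a b
    rw [hV, hV, hRB]

/-- A countably generated Hilbert `A`-module embeds in `ℓ²(A)` by a map that preserves the inner
products. For a generating sequence `g` of summable norms, the adjointable operator
`ξ ↦ ∑ g n · ξ n` from `ℓ²(A)` has dense range. -/
theorem IsCountablyGenerated.exists_preservesRinner [CompleteSpace F]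
    (hF : IsCountablyGenerated A F) : ∃ V : F →ₗ[ℂ] StdModule A, PreservesRinner A V := by
  obtain ⟨g, hg⟩ := hF
  let c : ℕ → ℝ := fun n => (1 / 2) ^ n / (1 + ‖g n‖)
  have hc : ∀ n, 0 < c n := fun n => by positivity
  let f : ℕ → F := fun n => (c n : ℂ) • g n
  have hf : Summable fun n => ‖f n‖ := by
    refine Summable.of_nonneg_of_le (fun n => norm_nonneg _) (fun n => ?_) summable_geometric_two
    rw [norm_smul, Complex.norm_real, Real.norm_of_nonneg (hc n).le, div_mul_eq_mul_div,
      div_le_iff₀ (by positivity)]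
    gcongr
    linarith [norm_nonneg (g n)]
  let b : ℕ → StdModule A →L[ℂ] F := fun n => (opSMulL A F (f n)).comp (StdModule.coordL n)
  let w : ℕ → F →L[ℂ] StdModule A := fun n =>
    ((StdModule.singleₗ n).mkContinuous 1 fun a => by simp [StdModule.norm_single]).comp
      (rinnerL A (f n))
  have hb : Summable b := by
    refine Summable.of_norm_bounded hf fun n => ?_
    refine ContinuousLinearMap.opNorm_le_bound _ (norm_nonneg _) fun ξ => ?_
    exact (norm_op_smul_le _ _).trans (by gcongr; exact StdModule.norm_apply_le ξ n)
  have hw : Summable w := by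
    refine Summable.of_norm_bounded hf fun n => ?_
    refine ContinuousLinearMap.opNorm_le_bound _ (norm_nonneg _) fun z => ?_
    exact (StdModule.norm_single n _).trans_le (norm_rinner_le A _ _)
  have hbw : ∀ n ξ z, rinner A (b n ξ) z = rinner A ξ (w n z) := fun n ξ z => by
    change rinner A (op (ξ n) • f n) z = rinner A ξ (StdModule.single n (rinner A (f n) z))
    rw [rinner_smul_left, StdModule.rinner_single_right]
  have hBW : ∀ ξ z, rinner A ((∑' n, b n) ξ) z = rinner A ξ ((∑' n, w n) z) := fun ξ z => by
    have h1 := (hb.hasSum.mapL (ContinuousLinearMap.apply ℂ F ξ)).mapL (rinnerL A z)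
    have h2 := (hw.hasSum.mapL (ContinuousLinearMap.apply ℂ _ z)).mapL (rinnerL A ξ)
    have h3 := h1.star
    simp only [ContinuousLinearMap.apply_apply, rinnerL_apply, rinner_star, hbw] at h2 h3
    exact h3.unique h2
  refine exists_preservesRinner_of_denseRange hBW ?_
  have hsub : Submodule.span ℂ {z : F | ∃ (n : ℕ) (a : A), z = op a • g n} ≤
      LinearMap.range (∑' n, b n : StdModule A →L[ℂ] F).toLinearMap := by
    refine Submodule.span_le.2 ?_
    rintro _ ⟨n, a, rfl⟩
    refine ⟨StdModule.single n ((c n : ℂ)⁻¹ • a), ?_⟩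
    have h1 := hb.hasSum.mapL
      (ContinuousLinearMap.apply ℂ F (StdModule.single n ((c n : ℂ)⁻¹ • a)))
    have h2 : (c n : ℂ) ≠ 0 := by exact_mod_cast (hc n).ne'
    refine h1.unique (a₂ := op a • g n) ?_
    convert hasSum_single n fun m hm => ?_ using 1
    · change op a • g n = op (StdModule.single n ((c n : ℂ)⁻¹ • a) n) • (c n : ℂ) • g n
      rw [StdModule.single_apply_self, op_smul_complex, op_complex_smul, smul_smul,
        mul_inv_cancel₀ h2, one_smul]
    · change op (StdModule.single n ((c n : ℂ)⁻¹ • a) m) • f m = 0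
      rw [StdModule.single_apply, if_neg hm]
      exact (opSMulL A F (f m)).map_zero
  exact hg.mono hsub

end Embedding

/-! ### Compressing compact operators along non-adjointable embeddings -/

section Transfer

variable {A : Type*} [NonUnitalCStarAlgebra A] [PartialOrder A] [StarOrderedRing A]
variable {F : Type*} [NormedAddCommGroup F] [NormedSpace ℂ F] [SMul Aᵐᵒᵖ F] [CStarModule Aᵐᵒᵖ F]
variable {G : Type*} [NormedAddCommGroup G] [NormedSpace ℂ G] [SMul Aᵐᵒᵖ G] [CStarModule Aᵐᵒᵖ G]

/-- `X = U T V⋆`, for maps `U`, `V` that preserve inner products but need not have adjoints: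
`X` and `X⋆` are prescribed on the ranges of `V` and `U`, and map into the ranges of `U`
and `V`. -/
structure IsTransfer (U V : F →ₗ[ℂ] G) (T : Adjointable A F) (X : Adjointable A G) : Prop where
  apply_right : ∀ z, X (V z) = U (T z)
  star_apply_left : ∀ z, star X (U z) = V (star T z)
  mem_range : ∀ η, X η ∈ LinearMap.range U
  star_mem_range : ∀ η, star X η ∈ LinearMap.range V

theorem IsTransfer.norm_le {U V : F →ₗ[ℂ] G} (hU : PreservesRinner A U)
    (hV : PreservesRinner A V) {T : Adjointable A F} {X : Adjointable A G}
    (h : IsTransfer U V T X) : ‖X‖ ≤ ‖T‖ := by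
  -- `X X⋆` only involves `X` on the range of `V`, where its norm is at most `‖T‖`
  have h1 : ‖X * star X‖ ≤ ‖T‖ * ‖X‖ := by
    refine Adjointable.norm_le _ (by positivity) fun η => ?_
    obtain ⟨z, hz⟩ := h.star_mem_range η
    rw [Adjointable.mul_apply, ← hz, h.apply_right, hU.norm_map]
    calc ‖T z‖ ≤ ‖T‖ * ‖z‖ := T.le_norm z
      _ = ‖T‖ * ‖star X η‖ := by rw [← hz, hV.norm_map]
      _ ≤ ‖T‖ * (‖star X‖ * ‖η‖) := by gcongr; exact (star X).le_norm η
      _ = ‖T‖ * ‖X‖ * ‖η‖ := by rw [norm_star]; ring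
  rw [CStarRing.norm_self_mul_star] at h1
  by_cases h0 : ‖X‖ = 0
  · rw [h0]; positivity
  · exact le_of_mul_le_mul_right h1 (lt_of_le_of_ne (norm_nonneg _) (Ne.symm h0))

/-- A "compact" operator `T` can be transferred to `U T V⋆`, within any closed subspace that
contains the rank one operators `z ↦ U x · ⟨V y, z⟩`. -/
theorem exists_isTransfer [CompleteSpace F] [CompleteSpace G] {U V : F →ₗ[ℂ] G}
    (hU : PreservesRinner A U) (hV : PreservesRinner A V) {p : Submodule ℂ (Adjointable A G)}
    (hp : IsClosed (p : Set (Adjointable A G)))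
    (hmem : ∀ x y, Adjointable.rankOne (U x) (V y) ∈ p) {T : Adjointable A F}
    (hT : T ∈ compacts A F) : ∃ X ∈ p, IsTransfer U V T X := by
  -- the graph of the correspondence between `T` and `X` is a closed subspace on which the first
  -- projection is bounded below, so that this projection has closed range
  let Γ : Submodule ℂ (Adjointable A F × Adjointable A G) :=
    { carrier := {q | q.2 ∈ p ∧ IsTransfer U V q.1 q.2}
      zero_mem' := ⟨p.zero_mem, fun z => by simp, fun z => by simp, fun η => by simp,
        fun η => by simp⟩
      add_mem' := by
        rintro ⟨T, X⟩ ⟨T', X'⟩ ⟨h1, h2⟩ ⟨h1', h2'⟩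
        refine ⟨p.add_mem h1 h1', fun z => ?_, fun z => ?_, fun η => ?_, fun η => ?_⟩
        · simp [h2.apply_right, h2'.apply_right]
        · simp [h2.star_apply_left, h2'.star_apply_left]
        · exact Submodule.add_mem _ (h2.mem_range η) (h2'.mem_range η)
        · simpa using Submodule.add_mem _ (h2.star_mem_range η) (h2'.star_mem_range η)
      smul_mem' := by
        rintro c ⟨T, X⟩ ⟨h1, h2⟩
        refine ⟨p.smul_mem c h1, fun z => ?_, fun z => ?_, fun η => ?_, fun η => ?_⟩
        · simp [h2.apply_right]
        · simp [h2.star_apply_left]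
        · exact Submodule.smul_mem _ c (h2.mem_range η)
        · simpa using Submodule.smul_mem _ (star c) (h2.star_mem_range η) }
  have hΓ : IsClosed (Γ : Set (Adjointable A F × Adjointable A G)) := by
    have e1 : ∀ z, Continuous fun q : Adjointable A F × Adjointable A G => q.1 z := fun z =>
      (Adjointable.continuous_toCLM_apply z).comp continuous_fst
    have e2 : ∀ z, Continuous fun q : Adjointable A F × Adjointable A G => q.2 z := fun z =>
      (Adjointable.continuous_toCLM_apply z).comp continuous_snd
    have e3 : ∀ z, Continuous fun q : Adjointable A F × Adjointable A G => star q.1 z := fun z =>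
      (Adjointable.continuous_toCLM_apply z).comp (continuous_star.comp continuous_fst)
    have e4 : ∀ z, Continuous fun q : Adjointable A F × Adjointable A G => star q.2 z := fun z =>
      (Adjointable.continuous_toCLM_apply z).comp (continuous_star.comp continuous_snd)
    have hset : (Γ : Set (Adjointable A F × Adjointable A G)) =
        {q | q.2 ∈ p} ∩ ((⋂ z, {q | q.2 (V z) = U (q.1 z)}) ∩
          ((⋂ z, {q | (star q.2 : Adjointable A G) (U z) = V ((star q.1 : Adjointable A F) z)}) ∩
          ((⋂ η, {q | q.2 η ∈ Set.range U}) ∩ ⋂ η, {q | (star q.2 : Adjointable A G) η ∈ Set.range V}))) := by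
      ext q
      simp only [Set.mem_inter_iff, Set.mem_iInter, Set.mem_ofPred_eq]
      exact ⟨fun ⟨h1, h2⟩ => ⟨h1, h2.1, h2.2, h2.3, h2.4⟩,
        fun ⟨h1, h2, h3, h4, h5⟩ => ⟨h1, h2, h3, h4, h5⟩⟩
    rw [hset]
    refine (hp.preimage continuous_snd).inter ((isClosed_iInter fun z => ?_).inter
      ((isClosed_iInter fun z => ?_).inter ((isClosed_iInter fun η => ?_).inter
        (isClosed_iInter fun η => ?_))))
    · exact isClosed_eq (e2 _) (hU.isometry.continuous.comp (e1 z))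
    · exact isClosed_eq (e4 _) (hV.isometry.continuous.comp (e3 z))
    · exact hU.isClosed_range.preimage (e2 η)
    · exact hV.isClosed_range.preimage (e4 η)
  have : CompleteSpace Γ := hΓ.completeSpace_coe
  let π : Γ →L[ℂ] Adjointable A F := (ContinuousLinearMap.fst ℂ _ _).comp Γ.subtypeL
  have hπ : AntilipschitzWith 1 π := by
    refine AddMonoidHomClass.antilipschitz_of_bound π fun q => ?_
    have := q.2.2.norm_le hU hV
    change ‖(q : Adjointable A F × Adjointable A G)‖ ≤ (1 : NNReal) * ‖q.1.1‖
    simpa [Prod.norm_def] using this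
  have hcl : IsClosed (LinearMap.range π.toLinearMap : Set (Adjointable A F)) :=
    hπ.isClosed_range π.uniformContinuous
  have hle : compacts A F ≤ LinearMap.range π.toLinearMap := by
    refine Adjointable.compacts_le_of_rankOne hcl fun x y => ?_
    refine ⟨⟨(Adjointable.rankOne x y, Adjointable.rankOne (U x) (V y)), hmem x y, ?_⟩, rfl⟩
    refine ⟨fun z => ?_, fun z => ?_, fun η => ⟨op (rinner A (V y) η) • x, ?_⟩,
      fun η => ⟨op (rinner A (U x) η) • y, ?_⟩⟩
    · simp [hV y z, hU.map_op_smul]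
    · simp [Adjointable.star_rankOne, hU x z, hV.map_op_smul]
    · simp [hU.map_op_smul]
    · simp [Adjointable.star_rankOne, hV.map_op_smul]
  obtain ⟨⟨q, hq⟩, rfl⟩ := hle hT
  exact ⟨q.2, hq.1, hq.2⟩

/-- Let `v` be an inner product preserving map of `F` into itself, and `T` a self-adjoint
operator that fixes the range of `v`. For an embedding `V` of `F`, the operator
`X = V v T V⋆` satisfies `X⋆ X X X⋆ = X X⋆`. If moreover `X⋆ X = X X⋆`, then `v` is onto. -/
theorem IsTransfer.scaling {v : F →ₗ[ℂ] F} {V : F →ₗ[ℂ] G} (hV : PreservesRinner A V)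
    (hv : PreservesRinner A v) {T : Adjointable A F} (hT : IsSelfAdjoint T)
    (hTv : ∀ z, T (v z) = v z) {X : Adjointable A G} (hX : IsTransfer (V ∘ₗ v) V T X) :
    star X * X * (X * star X) = X * star X ∧
      (star X * X = X * star X → Function.Surjective v) := by
  have hX1 : ∀ z, X (V z) = V (v (T z)) := hX.apply_right
  have hX2 : ∀ z, star X (V (v z)) = V (T z) := fun z => by
    have := hX.star_apply_left z
    rwa [hT.star_eq] at this
  constructor
  · ext η
    obtain ⟨z, hz⟩ := hX.mem_range (star X η)
    simp only [Adjointable.mul_apply, ← hz, LinearMap.comp_apply, hX1, hTv, hX2]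
  · intro h
    have hVinj : Function.Injective V := hV.isometry.injective
    have hvinj : Function.Injective v := hv.isometry.injective
    have hTT : ∀ z, T (T z) ∈ LinearMap.range v := fun z => by
      have h1 : V (T (T z)) = (X * star X) (V z) := by
        rw [← h, Adjointable.mul_apply, hX1, hX2]
      obtain ⟨y, hy⟩ := hX.mem_range (star X (V z))
      exact ⟨y, hVinj (by rw [h1]; exact hy)⟩
    have hTsurj : Function.Surjective T := fun f => by
      have h1 : (X * star X) (V (v f)) = V (v f) := by
        rw [← h, Adjointable.mul_apply, hX1, hTv, hX2, hTv]
      obtain ⟨y, hy⟩ := hX.star_mem_range (V (v f))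
      rw [Adjointable.mul_apply, ← hy, hX1] at h1
      exact ⟨y, hvinj (hVinj h1)⟩
    intro f
    obtain ⟨y, rfl⟩ := hTsurj f
    obtain ⟨z, rfl⟩ := hTsurj y
    exact hTT z

end Transfer

/-! ### Matrix units and the stabilization -/

section MatUnit

variable {A : Type*} [NonUnitalCStarAlgebra A] [PartialOrder A] [StarOrderedRing A]

open StdModule Adjointable

/-- The standard basis of `ℓ²(ℕ)`. -/
noncomputable def stdBasis (i : ℕ) : lp (fun _ : ℕ => ℂ) 2 := lp.single 2 i 1

theorem inner_stdBasis_left (i : ℕ) (v : lp (fun _ : ℕ => ℂ) 2) :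
    inner ℂ (stdBasis i) v = v i := by
  rw [stdBasis, lp.inner_single_left]
  simp

theorem stdBasis_apply (i j : ℕ) : stdBasis i j = if j = i then 1 else 0 := by
  rw [stdBasis, lp.single_apply]
  exact Pi.single_apply i (1 : ℂ) j

theorem tmul_apply (b : A) (v : lp (fun _ : ℕ => ℂ) 2) (i : ℕ) : tmul b v i = v i • b := rfl

theorem tmul_stdBasis (b : A) (i : ℕ) : tmul b (stdBasis i) = single i b := by
  ext j
  rw [tmul_apply, stdBasis_apply, single_apply]
  split_ifs <;> simp

theorem tmul_sub_right (b : A) (v w : lp (fun _ : ℕ => ℂ) 2) :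
    tmul b (v - w) = tmul b v - tmul b w := by
  ext i
  simp [tmul_apply, sub_smul]

theorem rinner_tmul (b c : A) (v w : lp (fun _ : ℕ => ℂ) 2) :
    rinner A (tmul b v) (tmul c w) = inner ℂ v w • (star b * c) := by
  rw [rinner_eq_tsum]
  refine (((lp.hasSum_inner v w).smul_const (star b * c)).congr_fun fun i => ?_).tsum_eq
  simp [tmul_apply, smul_mul_smul_comm, mul_comm]

/-- The operator `a ⊗ e_{ij}` on `ℓ²(A)`, with `e_{ij}` the `(i, j)` matrix unit. -/
noncomputable def matUnit (i j : ℕ) (a : A) : Adjointable A (StdModule A) :=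
  have key : ∀ i j (a : A), ∃ T : StdModule A →L[ℂ] StdModule A, ∀ ξ, T ξ = single i (a * ξ j) :=
    fun i j a => ⟨LinearMap.mkContinuous
      (singleₗ i ∘ₗ LinearMap.mulLeft ℂ a ∘ₗ (coordL j).toLinearMap) ‖a‖ fun ξ => by
        change ‖single i (a * ξ j)‖ ≤ _
        rw [norm_single]
        exact (norm_mul_le _ _).trans (by gcongr; exact norm_apply_le ξ j), fun ξ => rfl⟩
  ⟨(key i j a).choose, (key j i (star a)).choose, fun ξ η => by
    rw [(key i j a).choose_spec, (key j i (star a)).choose_spec, rinner_single_left,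
      rinner_single_right, star_mul, mul_assoc]⟩

theorem matUnit_apply (i j : ℕ) (a : A) (ξ : StdModule A) :
    matUnit i j a ξ = single i (a * ξ j) := by
  unfold matUnit
  exact Exists.choose_spec (p := fun T : StdModule A →L[ℂ] StdModule A =>
    ∀ ξ, T ξ = single i (a * ξ j)) _ ξ

theorem star_matUnit (i j : ℕ) (a : A) : star (matUnit i j a) = matUnit j i (star a) :=
  star_eq fun ξ η => by
    rw [matUnit_apply, matUnit_apply, rinner_single_left, rinner_single_right, star_mul, mul_assoc]

theorem matUnit_add (i j : ℕ) (a b : A) : matUnit i j (a + b) = matUnit i j a + matUnit i j b := by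
  ext ξ : 1
  simp only [matUnit_apply, Adjointable.add_apply, add_mul, ← singleₗ_apply, map_add]

theorem matUnit_smul (i j : ℕ) (c : ℂ) (a : A) : matUnit i j (c • a) = c • matUnit i j a := by
  ext ξ : 1
  simp only [matUnit_apply, Adjointable.smul_apply, smul_mul_assoc, ← singleₗ_apply, map_smul]

theorem matUnit_zero (i j : ℕ) : matUnit i j (0 : A) = 0 := by
  simpa using matUnit_smul i j (0 : ℂ) (0 : A)

theorem matUnit_sum {ι : Type*} (i j : ℕ) (s : Finset ι) (a : ι → A) :
    matUnit i j (∑ k ∈ s, a k) = ∑ k ∈ s, matUnit i j (a k) :=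
  map_sum (AddMonoidHom.mk' (matUnit i j) (matUnit_add i j)) a s

theorem matUnit_mul (i j k l : ℕ) (a b : A) :
    matUnit i j a * matUnit k l b = if j = k then matUnit i l (a * b) else 0 := by
  ext ξ : 1
  rw [Adjointable.mul_apply, matUnit_apply, matUnit_apply, single_apply]
  split_ifs
  · rw [matUnit_apply, mul_assoc]
  · rw [mul_zero, ← singleₗ_apply, map_zero, Adjointable.zero_apply]

theorem rankOne_single (i j : ℕ) (a b : A) :
    rankOne (single i a) (single j b) = matUnit i j (a * star b) := by
  ext ξ : 1
  rw [rankOne_apply, matUnit_apply, rinner_single_left, op_smul_single, mul_assoc]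

theorem isCompactOperator_rankOne {H : Type*} [NormedAddCommGroup H] [InnerProductSpace ℂ H]
    (x y : H) : IsCompactOperator (InnerProductSpace.rankOne ℂ x y) :=
  IsCompactOperator.clm_comp (isCompactOperator_of_locallyCompactSpace_dom (innerSL ℂ y))
    (ContinuousLinearMap.toSpanSingleton ℂ x)

theorem matUnit_mem_stabilization (i j : ℕ) (a : A) : matUnit i j a ∈ stabilization A := by
  refine NonUnitalStarSubalgebra.le_topologicalClosure _
    (NonUnitalStarAlgebra.subset_adjoin ℂ _ ?_)
  refine ⟨a, InnerProductSpace.rankOne ℂ (stdBasis i) (stdBasis j), ?_, fun b v => ?_⟩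
  · exact isCompactOperator_rankOne _ _
  · rw [matUnit_apply, InnerProductSpace.rankOne_apply, inner_stdBasis_left]
    ext k
    rw [single_apply, tmul_apply, tmul_apply, lp.coeFn_smul, Pi.smul_apply, stdBasis_apply]
    split_ifs <;> simp [mul_smul_comm]

theorem isClosed_stabilization :
    IsClosed (stabilization A : Set (Adjointable A (StdModule A))) :=
  NonUnitalStarSubalgebra.isClosed_topologicalClosure _

theorem rankOne_mem_stabilization (ξ η : StdModule A) : rankOne ξ η ∈ stabilization A := by
  have hc : ∀ ξ : StdModule A, Continuous fun η => rankOne ξ η := fun ξ => by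
    let f : StdModule A →+ Adjointable A (StdModule A) :=
      { toFun := fun η => rankOne ξ η
        map_zero' := by simpa using rankOne_add_right ξ 0 0
        map_add' := rankOne_add_right ξ }
    exact AddMonoidHomClass.continuous_of_bound f ‖ξ‖ fun η => norm_rankOne_le ξ η
  have hc' : ∀ η : StdModule A, Continuous fun ξ => rankOne ξ η := fun η => by
    simpa only [Function.comp_def, star_rankOne] using continuous_star.comp (hc η)
  have hfin : ∀ s t : Finset ℕ, rankOne (trunc s ξ) (trunc t η) ∈ stabilization A := by
    intro s t
    have : (rankOne (trunc s ξ) (trunc t η) : Adjointable A (StdModule A)) =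
        ∑ i ∈ s, ∑ j ∈ t, rankOne (single i (ξ i)) (single j (η j)) := by
      ext ζ : 1
      simp only [finsetSum_apply, rankOne_apply, trunc, rinner_sum_left, ← opSMulL_apply, map_sum,
        _root_.sum_apply]
      rw [Finset.sum_comm]
    rw [this]
    refine sum_mem fun i _ => sum_mem fun j _ => ?_
    rw [rankOne_single]
    exact matUnit_mem_stabilization i j _
  have h1 : ∀ s, rankOne (trunc s ξ) η ∈ stabilization A := fun s =>
    isClosed_stabilization.mem_of_tendsto (((hc _).tendsto η).comp (tendsto_trunc η))
      (Filter.Eventually.of_forall fun t => hfin s t)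
  exact isClosed_stabilization.mem_of_tendsto (((hc' η).tendsto ξ).comp (tendsto_trunc ξ))
    (Filter.Eventually.of_forall h1)

end MatUnit

/-! ### Compactly contained copies of a module -/

/-- A Hilbert submodule that is compactly contained in a countably generated Hilbert module and
isomorphic to it is everything, unless `A ⊗ K` contains a scaling element. -/
theorem IsCompactlyContained.eq_top_or_scaling {A : Type*} [NonUnitalCStarAlgebra A]
    [PartialOrder A] [StarOrderedRing A] {F : Type*} [NormedAddCommGroup F] [NormedSpace ℂ F]
    [CompleteSpace F] [SMul Aᵐᵒᵖ F] [CStarModule Aᵐᵒᵖ F] (hF : IsCountablyGenerated A F)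
    {E : Submodule ℂ F} (hE : IsCompactlyContained A E) (hiso : IsIsomorphicToWhole A E) :
    E = ⊤ ∨ StabilizationHasScalingElement A := by
  obtain ⟨-, T, hTc, hT, hTE⟩ := hE
  obtain ⟨u, -, hu⟩ := hiso
  obtain ⟨V, hV⟩ := hF.exists_preservesRinner
  let v : F →ₗ[ℂ] F := E.subtype ∘ₗ u.symm.toLinearMap
  have hv : PreservesRinner A v := fun x y => by
    have h := hu (u.symm x) (u.symm y)
    rw [u.apply_symm_apply, u.apply_symm_apply] at h
    exact h.symm
  obtain ⟨X, hXmem, hX⟩ := exists_isTransfer (hV.comp hv) hV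
    (p := (stabilization A).toSubmodule) isClosed_stabilization
    (fun x y => rankOne_mem_stabilization _ _) hTc
  obtain ⟨h1, h2⟩ := hX.scaling hV hv hT fun z => hTE _ (u.symm z).2
  by_cases h : star X * X = X * star X
  · refine Or.inl (Submodule.eq_top_iff'.2 fun f => ?_)
    obtain ⟨z, rfl⟩ := h2 h f
    exact (u.symm z).2
  · exact Or.inr ⟨⟨X, hXmem⟩, Subtype.ext h1, fun h' => h (congrArg Subtype.val h')⟩

/-! ### Finite matrices are dense in the stabilization -/

section Truncation

/-- The projection of `ℓ²(ℕ)` onto the span of the first `n` basis vectors. -/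
noncomputable def stdProj (n : ℕ) : lp (fun _ : ℕ => ℂ) 2 →L[ℂ] lp (fun _ : ℕ => ℂ) 2 :=
  ∑ i ∈ Finset.range n, InnerProductSpace.rankOne ℂ (stdBasis i) (stdBasis i)

theorem stdProj_eq_sum (n : ℕ) (v : lp (fun _ : ℕ => ℂ) 2) :
    stdProj n v = ∑ i ∈ Finset.range n, lp.single 2 i (v i) := by
  simp only [stdProj, _root_.sum_apply, InnerProductSpace.rankOne_apply, inner_stdBasis_left]
  refine Finset.sum_congr rfl fun i _ => ?_
  rw [stdBasis, ← lp.single_smul, smul_eq_mul, mul_one]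

theorem stdProj_apply (n : ℕ) (v : lp (fun _ : ℕ => ℂ) 2) (i : ℕ) :
    stdProj n v i = if i < n then v i else 0 := by
  rw [stdProj_eq_sum, lp.coeFn_sum, Finset.sum_apply]
  simp only [lp.single_apply, Pi.single_apply]
  simp

theorem norm_stdProj_apply_le (n : ℕ) (v : lp (fun _ : ℕ => ℂ) 2) : ‖stdProj n v‖ ≤ ‖v‖ := by
  refine le_of_sq_le_sq ?_ (norm_nonneg _)
  have h1 := lp.norm_sum_single (p := 2) (by norm_num) (fun i => v i) (Finset.range n)
  have h2 := lp.sum_rpow_le_norm_rpow (p := 2) (by norm_num) v (Finset.range n)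
  rw [← stdProj_eq_sum] at h1
  simp only [ENNReal.toReal_ofNat, Real.rpow_ofNat] at h1 h2
  rw [h1]
  exact h2

theorem tendsto_stdProj (v : lp (fun _ : ℕ => ℂ) 2) :
    Filter.Tendsto (fun n => stdProj n v) Filter.atTop (nhds v) := by
  simp only [stdProj_eq_sum]
  exact (lp.hasSum_single (by norm_num) v).tendsto_sum_nat

theorem adjoint_stdProj (n : ℕ) : star (stdProj n) = stdProj n := by
  simp [stdProj, star_sum, ContinuousLinearMap.star_eq_adjoint]

theorem isCompactOperator_stdProj (n : ℕ) : IsCompactOperator (stdProj n) := by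
  have : stdProj n ∈ compactOperator (RingHom.id ℂ) (lp (fun _ : ℕ => ℂ) 2)
      (lp (fun _ : ℕ => ℂ) 2) := sum_mem fun i _ => isCompactOperator_rankOne _ _
  exact this

/-- The projections `stdProj n` converge strongly to the identity and are contractions, hence
converge uniformly on the relatively compact image of the unit ball under `k`. -/
theorem exists_norm_sub_stdProj_mul_le
    {k : lp (fun _ : ℕ => ℂ) 2 →L[ℂ] lp (fun _ : ℕ => ℂ) 2} (hk : IsCompactOperator k) {ε : ℝ}
    (hε : 0 < ε) : ∃ n, ‖k - stdProj n * k‖ ≤ ε := by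
  obtain ⟨K, hK, hkK⟩ := hk.image_closedBall_subset_compact (𝕜₁ := ℂ) (f := k.toLinearMap) 1
  obtain ⟨t, -, htfin, ht⟩ := hK.finite_cover_balls (show 0 < ε / 3 by positivity)
  have hev : ∀ᶠ n in Filter.atTop, ∀ y ∈ t, ‖stdProj n y - y‖ < ε / 3 := by
    rw [Filter.eventually_all_finite htfin]
    intro y _
    have := Metric.tendsto_nhds.1 (tendsto_stdProj y) (ε / 3) (by positivity)
    simpa [dist_eq_norm] using this
  obtain ⟨n, hn⟩ := hev.exists
  refine ⟨n, ContinuousLinearMap.opNorm_le_of_unit_norm hε.le fun v hv => ?_⟩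
  have hvK : k v ∈ K := hkK ⟨v, by simp [hv], rfl⟩
  obtain ⟨y, hy, hky⟩ := Set.mem_iUnion₂.1 (ht hvK)
  rw [Metric.mem_ball, dist_eq_norm] at hky
  have h1 : (k - stdProj n * k) v =
      (k v - y) - stdProj n (k v - y) - (stdProj n y - y) := by
    simp only [sub_apply, map_sub]
    change k v - stdProj n (k v) = _
    abel
  rw [h1]
  have h2 := norm_stdProj_apply_le n (k v - y)
  have h3 := hn y hy
  calc _ ≤ ‖k v - y‖ + ‖stdProj n (k v - y)‖ + ‖stdProj n y - y‖ :=
        (norm_sub_le _ _).trans (by gcongr; exact norm_sub_le _ _)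
    _ ≤ ε := by linarith

/-- A compact operator on `ℓ²(ℕ)` is approximated by its finite compressions. On the right, this
uses that the adjoint `k⋆ P` of `P k` has finite rank. -/
theorem exists_norm_sub_stdProj_mul_mul_le
    {k : lp (fun _ : ℕ => ℂ) 2 →L[ℂ] lp (fun _ : ℕ => ℂ) 2} (hk : IsCompactOperator k) {ε : ℝ}
    (hε : 0 < ε) : ∃ n m, ‖k - stdProj n * k * stdProj m‖ ≤ ε := by
  obtain ⟨n, hn⟩ := exists_norm_sub_stdProj_mul_le hk (half_pos hε)
  have hc : IsCompactOperator (star k * stdProj n) :=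
    (isCompactOperator_stdProj n).clm_comp (star k)
  obtain ⟨m, hm⟩ := exists_norm_sub_stdProj_mul_le hc (half_pos hε)
  refine ⟨n, m, ?_⟩
  rw [← norm_star] at hm
  simp only [star_sub, star_mul, star_star, adjoint_stdProj] at hm
  calc _ = ‖(k - stdProj n * k) + (stdProj n * k - stdProj n * k * stdProj m)‖ := by
        congr 1; abel
    _ ≤ ε / 2 + ε / 2 := (norm_add_le _ _).trans (add_le_add hn hm)
    _ = ε := add_halves ε

end Truncation

section Density

open StdModule Adjointable

variable {A : Type*} [NonUnitalCStarAlgebra A] [PartialOrder A] [StarOrderedRing A]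

theorem exists_norm_sq_sub_star_mul_self {H : Type*} [NormedAddCommGroup H]
    [InnerProductSpace ℂ H] [CompleteSpace H] (k : H →L[ℂ] H) :
    ∃ c : H →L[ℂ] H, algebraMap ℝ (H →L[ℂ] H) (‖k‖ ^ 2) - star k * k = star c * c :=
  CStarAlgebra.nonneg_iff_eq_star_mul_self.1
    (sub_nonneg.2 (CStarAlgebra.star_mul_le_algebraMap_norm_sq (a := k)))

/-- For a bounded operator `k` on `ℓ²(ℕ)` and finitely many elements of `A`, the vector
`∑ a i ⊗ k (e i)` has norm at most `‖k‖` times that of `∑ a i ⊗ e i`. With `c` such that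
`c⋆ c = ‖k‖² - k⋆ k`, the difference of the squares of the two sides is the square of
`∑ a i ⊗ c (e i)`. -/
theorem norm_sum_tmul_le (k : lp (fun _ : ℕ => ℂ) 2 →L[ℂ] lp (fun _ : ℕ => ℂ) 2)
    (s : Finset ℕ) (a : ℕ → A) :
    ‖∑ i ∈ s, tmul (a i) (k (stdBasis i))‖ ≤ ‖k‖ * ‖∑ i ∈ s, single i (a i)‖ := by
  obtain ⟨c, hc⟩ := exists_norm_sq_sub_star_mul_self k
  have hinner : ∀ i j, ((‖k‖ ^ 2 : ℝ) : ℂ) * inner ℂ (stdBasis i) (stdBasis j) =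
      inner ℂ (k (stdBasis i)) (k (stdBasis j)) + inner ℂ (c (stdBasis i)) (c (stdBasis j)) := by
    intro i j
    have h1 := congrArg (fun T => inner ℂ (stdBasis i) (T (stdBasis j))) hc
    simp only [_root_.sub_apply, inner_sub_right,
      ContinuousLinearMap.star_eq_adjoint, mul_apply_eq_comp,
      ContinuousLinearMap.adjoint_inner_right] at h1
    rw [← sub_eq_iff_eq_add', ← h1, Algebra.algebraMap_eq_smul_one, ← inner_smul_right]
    rfl
  have hexp : ∀ T : lp (fun _ : ℕ => ℂ) 2 →L[ℂ] lp (fun _ : ℕ => ℂ) 2,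
      rinner A (∑ i ∈ s, tmul (a i) (T (stdBasis i))) (∑ i ∈ s, tmul (a i) (T (stdBasis i))) =
      ∑ i ∈ s, ∑ j ∈ s, inner ℂ (T (stdBasis i)) (T (stdBasis j)) • (star (a i) * a j) := by
    intro T
    simp only [rinner_sum_left, rinner_sum_right, rinner_tmul]
    exact Finset.sum_comm
  have hle : rinner A (∑ i ∈ s, tmul (a i) (k (stdBasis i)))
      (∑ i ∈ s, tmul (a i) (k (stdBasis i))) ≤
      ((‖k‖ ^ 2 : ℝ) : ℂ) • rinner A (∑ i ∈ s, single i (a i)) (∑ i ∈ s, single i (a i)) := by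
    have h1 := hexp 1
    simp only [one_apply_eq_self, tmul_stdBasis] at h1
    have h2 := rinner_self_nonneg (A := A) (∑ i ∈ s, tmul (a i) (c (stdBasis i)))
    rw [hexp] at h2
    rw [h1, hexp, ← sub_nonneg]
    convert h2 using 1
    simp only [Finset.smul_sum, smul_smul, hinner, ← Finset.sum_sub_distrib, add_smul,
      add_sub_cancel_left]
  refine le_of_sq_le_sq ?_ (by positivity)
  rw [norm_sq_rinner A, mul_pow, norm_sq_rinner A (E := StdModule A)]
  refine (CStarAlgebra.norm_le_norm_of_nonneg_of_le (rinner_self_nonneg _) hle).trans_eq ?_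
  rw [norm_smul, Complex.norm_real, Real.norm_of_nonneg (by positivity)]

theorem norm_sum_single_mul_le (a : A) (s : Finset ℕ) (b : ℕ → A) :
    ‖∑ i ∈ s, single i (a * b i)‖ ≤ ‖a‖ * ‖∑ i ∈ s, single i (b i)‖ := by
  have h : ∀ f : ℕ → A, rinner A (∑ i ∈ s, single i (f i)) (∑ i ∈ s, single i (f i)) =
      ∑ i ∈ s, star (f i) * f i := by
    intro f
    rw [rinner_sum_left]
    refine Finset.sum_congr rfl fun i hi => ?_
    rw [rinner_single_left, StdModule.sum_apply]
    simp [single_apply, hi]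
  refine le_of_sq_le_sq ?_ (by positivity)
  rw [norm_sq_rinner A, mul_pow, norm_sq_rinner A (E := StdModule A), h, h]
  calc _ ≤ ‖(‖a‖ ^ 2) • ∑ i ∈ s, star (b i) * b i‖ := by
        refine CStarAlgebra.norm_le_norm_of_nonneg_of_le
          (Finset.sum_nonneg fun i _ => star_mul_self_nonneg _) ?_
        rw [Finset.smul_sum]
        refine Finset.sum_le_sum fun i _ => ?_
        have := CStarAlgebra.star_left_conjugate_le_norm_smul (a := b i) (b := star a * a)
        rw [CStarRing.norm_star_mul_self, ← sq] at this
        simpa [mul_assoc] using this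
    _ = _ := by rw [norm_smul, Real.norm_of_nonneg (by positivity)]

/-- An operator `a ⊗ k` on `ℓ²(A)` has norm at most `‖a‖ ‖k‖`. -/
theorem norm_le_of_apply_tmul {a : A} {k : lp (fun _ : ℕ => ℂ) 2 →L[ℂ] lp (fun _ : ℕ => ℂ) 2}
    {T : Adjointable A (StdModule A)} (hT : ∀ b v, T (tmul b v) = tmul (a * b) (k v)) :
    ‖T‖ ≤ ‖a‖ * ‖k‖ := by
  refine T.norm_le (by positivity) fun ξ => ?_
  refine StdModule.induction_closed (isClosed_le T.toCLM.continuous.norm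
    (continuous_const.mul continuous_norm)) (fun s ξ => ?_) ξ
  have h1 : T (trunc s ξ) = ∑ i ∈ s, tmul (a * ξ i) (k (stdBasis i)) := by
    simp only [trunc, map_sum, ← tmul_stdBasis, hT]
  rw [h1]
  calc _ ≤ ‖k‖ * ‖∑ i ∈ s, single i (a * ξ i)‖ := norm_sum_tmul_le k s _
    _ ≤ ‖k‖ * (‖a‖ * ‖trunc s ξ‖) := by gcongr; exact norm_sum_single_mul_le a s _
    _ = ‖a‖ * ‖k‖ * ‖trunc s ξ‖ := by ring

/-- The action of `n × n` matrices over `A` on the first `n` coordinates of `ℓ²(A)`. -/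
noncomputable def matrixHom (A : Type*) [NonUnitalCStarAlgebra A] [PartialOrder A]
    [StarOrderedRing A] (n : ℕ) :
    CStarMatrix (Fin n) (Fin n) A →⋆ₙₐ[ℂ] Adjointable A (StdModule A) where
  toFun M := ∑ i : Fin n, ∑ j : Fin n, matUnit i j (M i j)
  map_smul' c M := by
    simp [matUnit_smul, Finset.smul_sum]
  map_zero' := by simp [matUnit_zero]
  map_add' M N := by simp [matUnit_add, Finset.sum_add_distrib]
  map_mul' M N := by
    simp only [CStarMatrix.mul_apply, matUnit_sum, Finset.sum_mul_sum, matUnit_mul, Fin.val_inj]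
    refine Finset.sum_congr rfl fun i _ => ?_
    rw [Finset.sum_comm]
    conv_rhs => rw [Finset.sum_comm]
    refine Finset.sum_congr rfl fun j _ => ?_
    rw [eq_comm, Finset.sum_eq_single j (fun k _ hk => by simp [hk.symm]) (by simp)]
    simp
  map_star' M := by
    simp only [star_sum, star_matUnit, CStarMatrix.star_apply]
    rw [Finset.sum_comm]

theorem matrixHom_apply (n : ℕ) (M : CStarMatrix (Fin n) (Fin n) A) :
    matrixHom A n M = ∑ i : Fin n, ∑ j : Fin n, matUnit i j (M i j) := rfl

theorem matrixHom_apply_single (n : ℕ) (M : CStarMatrix (Fin n) (Fin n) A) (j : ℕ) (a : A)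
    (i : ℕ) : matrixHom A n M (single j a) i =
      if h : i < n ∧ j < n then M ⟨i, h.1⟩ ⟨j, h.2⟩ * a else 0 := by
  simp only [matrixHom_apply, finsetSum_apply, matUnit_apply, StdModule.sum_apply, single_apply]
  split_ifs with h
  · rw [Finset.sum_eq_single ⟨i, h.1⟩ _ (by simp), Finset.sum_eq_single ⟨j, h.2⟩ _ (by simp)]
    · simp
    · intro l _ hl
      have : (l : ℕ) ≠ j := fun h' => hl (Fin.ext h')
      simp [this]
    · intro l _ hl
      have : i ≠ (l : ℕ) := fun h' => hl (Fin.ext h'.symm)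
      simp [this]
  · refine Finset.sum_eq_zero fun l _ => Finset.sum_eq_zero fun m _ => ?_
    by_cases h1 : i = l
    · have : (m : ℕ) ≠ j := fun h2 => h ⟨h1 ▸ l.2, h2 ▸ m.2⟩
      simp [this]
    · simp [h1]

theorem matrixHom_injective (n : ℕ) : Function.Injective (matrixHom A n) := by
  refine (injective_iff_map_eq_zero _).2 fun M hM => ?_
  ext i j
  have h := congrArg (fun T : Adjointable A (StdModule A) => T (single j (star (M i j))) i) hM
  simp only [matrixHom_apply_single, i.2, j.2, and_self, dite_true] at h
  exact (CStarRing.mul_star_self_eq_zero_iff _).1 h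

/-- The operators on `ℓ²(A)` that are given by a finite matrix over `A`. Such an operator is in the
range of `matrixHom A n` for all large `n`; stated in this way, the condition is visibly stable
under the algebraic operations. -/
noncomputable def finiteMatrices (A : Type*) [NonUnitalCStarAlgebra A] [PartialOrder A]
    [StarOrderedRing A] : NonUnitalStarSubalgebra ℂ (Adjointable A (StdModule A)) where
  carrier := {S | ∀ᶠ n in Filter.atTop, S ∈ NonUnitalStarAlgHom.range (matrixHom A n)}
  zero_mem' := Filter.Eventually.of_forall fun _ => zero_mem _
  add_mem' h h' := (h.and h').mono fun _ hn => add_mem hn.1 hn.2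
  mul_mem' h h' := (h.and h').mono fun _ hn => mul_mem hn.1 hn.2
  smul_mem' c _ h := h.mono fun _ hn => SMulMemClass.smul_mem c hn
  star_mem' h := h.mono fun _ hn => star_mem hn

theorem mem_finiteMatrices {S : Adjointable A (StdModule A)} : S ∈ finiteMatrices A ↔
    ∀ᶠ n in Filter.atTop, S ∈ NonUnitalStarAlgHom.range (matrixHom A n) := Iff.rfl

theorem matUnit_mem_finiteMatrices (i j : ℕ) (a : A) : matUnit i j a ∈ finiteMatrices A := by
  filter_upwards [Filter.eventually_gt_atTop i, Filter.eventually_gt_atTop j] with n hi hj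
  refine ⟨CStarMatrix.ofMatrix (Matrix.single ⟨i, hi⟩ ⟨j, hj⟩ a), ?_⟩
  change matrixHom A n _ = _
  rw [matrixHom_apply, Finset.sum_eq_single ⟨i, hi⟩ _ (by simp),
    Finset.sum_eq_single ⟨j, hj⟩ _ (by simp)]
  · simp
  · intro l _ hl
    simp [hl.symm, matUnit_zero]
  · intro l _ hl
    simp [hl.symm, matUnit_zero]

/-- Every element of `A ⊗ K` is a norm limit of finite matrices over `A`. -/
theorem stabilization_le_closure :
    stabilization A ≤ (finiteMatrices A).topologicalClosure := by
  refine NonUnitalStarSubalgebra.topologicalClosure_minimal _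
    (NonUnitalStarAlgebra.adjoin_le ?_) (NonUnitalStarSubalgebra.isClosed_topologicalClosure _)
  rintro T ⟨a, k, hk, hT⟩
  refine Metric.mem_closure_iff.2 fun ε hε => ?_
  obtain ⟨n, m, hnm⟩ := exists_norm_sub_stdProj_mul_mul_le hk
    (show 0 < ε / (‖a‖ + 1) by positivity)
  let S : Adjointable A (StdModule A) :=
    ∑ i ∈ Finset.range n, ∑ j ∈ Finset.range m, matUnit i j (k (stdBasis j) i • a)
  have hS : ∀ b v, S (tmul b v) = tmul (a * b) ((stdProj n * k * stdProj m) v) := by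
    intro b v
    ext l
    have h1 : stdProj m v = ∑ j ∈ Finset.range m, v j • stdBasis j := by
      simp [stdProj, _root_.sum_apply, inner_stdBasis_left]
    simp only [S, finsetSum_apply, matUnit_apply, StdModule.sum_apply, single_apply, tmul_apply,
      mul_apply_eq_comp, stdProj_apply, h1, map_sum, map_smul, lp.coeFn_sum,
      Finset.sum_apply, lp.coeFn_smul, Pi.smul_apply, smul_mul_smul_comm, smul_eq_mul]
    rw [Finset.sum_comm]
    simp only [Finset.sum_ite_eq, Finset.mem_range]
    split_ifs
    · rw [Finset.sum_smul]
      simp only [mul_comm]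
    · simp
  refine ⟨S, sum_mem fun i _ => sum_mem fun j _ => matUnit_mem_finiteMatrices _ _ _, ?_⟩
  have h2 := norm_le_of_apply_tmul (T := T - S) (a := a) (k := k - stdProj n * k * stdProj m)
    fun b v => by rw [Adjointable.sub_apply, hT, hS, ← tmul_sub_right]; rfl
  rw [dist_eq_norm]
  calc ‖T - S‖ ≤ ‖a‖ * (ε / (‖a‖ + 1)) := h2.trans (by gcongr)
    _ < ε := by
      rw [mul_div_assoc', div_lt_iff₀ (by positivity)]
      nlinarith [norm_nonneg a]

end Density

/-! ### Scaling elements and non-unitary isometries -/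

section Isometry

theorem isUnit_one_add_star_mul_self {L : Type*} [CStarAlgebra L] (x : L) :
    IsUnit (1 + star x * x) := by
  let _ := CStarAlgebra.spectralOrder L
  have _ := CStarAlgebra.spectralOrderedRing L
  exact CStarAlgebra.isUnit_of_le (1 : L) (le_add_of_nonneg_right (star_mul_self_nonneg x))

/-- The element `(2 x + 1 - h) (1 + h)⁻¹` with `h = x⋆ x`. If `x` is a scaling element, it is a
non-unitary isometry. -/
noncomputable def scalingIsometry {L : Type*} [Ring L] [Star L] (x : L) : L :=
  (2 * x + 1 - star x * x) * Ring.inverse (1 + star x * x)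

variable {L : Type*} [CStarAlgebra L]

theorem scalingIsometry_mul (x : L) :
    scalingIsometry x * (1 + star x * x) = 2 * x + 1 - star x * x := by
  rw [scalingIsometry, mul_assoc, Ring.inverse_mul_cancel _ (isUnit_one_add_star_mul_self x),
    mul_one]

theorem map_scalingIsometry {C : Type*} [CStarAlgebra C] (Φ : C →⋆ₐ[ℂ] L) (x : C) :
    Φ (scalingIsometry x) = scalingIsometry (Φ x) := by
  refine (isUnit_one_add_star_mul_self (Φ x)).mul_right_cancel ?_
  rw [scalingIsometry_mul]
  have h := congrArg Φ (scalingIsometry_mul x)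
  simpa only [map_mul, map_add, map_sub, map_one, map_star, map_ofNat] using h

theorem continuous_scalingIsometry : Continuous (scalingIsometry : L → L) := by
  have h : Continuous fun x : L => Ring.inverse (1 + star x * x) := by
    refine continuous_iff_continuousAt.2 fun x => ?_
    obtain ⟨u, hu⟩ := isUnit_one_add_star_mul_self x
    have h1 := NormedRing.inverse_continuousAt u
    rw [hu] at h1
    exact ContinuousAt.comp (f := fun x : L => 1 + star x * x) h1
      (Continuous.continuousAt (by fun_prop))
  unfold scalingIsometry
  fun_prop

theorem IsScalingElement.one_sub_mul {x : L} (hx : IsScalingElement x) :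
    (1 - star x * x) * x = 0 := by
  rw [← CStarRing.mul_star_self_eq_zero_iff, star_mul]
  have h1 : (1 - star x * x) * (x * star x) = 0 := by rw [sub_mul, one_mul, hx.1, sub_self]
  rw [← mul_assoc, mul_assoc _ x, h1, zero_mul]

theorem IsScalingElement.star_mul_scalingIsometry {x : L} (hx : IsScalingElement x) :
    star (scalingIsometry x) * scalingIsometry x = 1 := by
  have hsa : star (1 + star x * x) = 1 + star x * x := by simp
  have h0 := hx.one_sub_mul
  have h0' : star x * (1 - star x * x) = 0 := by simpa using congrArg star h0
  have hw := scalingIsometry_mul x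
  have hu := isUnit_one_add_star_mul_self x
  refine hu.mul_left_cancel (hu.mul_right_cancel ?_)
  calc _ = star (scalingIsometry x * (1 + star x * x)) *
        (scalingIsometry x * (1 + star x * x)) := by rw [star_mul, hsa]; noncomm_ring
    _ = (1 + star x * x) * (1 + star x * x) +
        2 * (star x * (1 - star x * x)) + 2 * ((1 - star x * x) * x) := by
      rw [hw]
      simp only [star_sub, star_add, star_mul, star_star, star_one, star_ofNat]
      noncomm_ring
    _ = _ := by rw [h0, h0']; simp

theorem IsScalingElement.scalingIsometry_mul_star_ne {x : L} (hx : IsScalingElement x) :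
    scalingIsometry x * star (scalingIsometry x) ≠ 1 := by
  intro hv
  set v := scalingIsometry x with hvdef
  set h := star x * x with hh
  have hsa : star h = h := by simp [hh]
  have h0 : (1 - h) * x = 0 := hx.one_sub_mul
  have hw : v * (1 + h) = 2 * x + 1 - h := scalingIsometry_mul x
  have hu : IsUnit (1 + h) := isUnit_one_add_star_mul_self x
  -- `a = (1 - h) v` commutes with `1 + h` and satisfies `a (1 + h) = (1 - h)²`; as `v` is unitary,
  -- `a a⋆ = (1 - h)²`, so that `(1 - h)² (1 + h)² = (1 - h)⁴`
  have h1 : (1 - h) * v * (1 + h) = (1 - h) * (1 - h) := by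
    rw [mul_assoc, hw]
    calc _ = 2 * ((1 - h) * x) + (1 - h) * (1 - h) := by noncomm_ring
      _ = _ := by rw [h0]; simp
  have h2 : (1 + h) * (star v * (1 - h)) = (1 - h) * (1 - h) := by
    simpa [hsa, mul_assoc] using congrArg star h1
  have h3 : (1 - h) * (1 - h) * ((1 + h) * (1 + h)) =
      (1 - h) * (1 - h) * ((1 - h) * (1 - h)) := by
    have e1 : (1 + h) * ((1 - h) * v) = (1 - h) * v * (1 + h) := by
      refine hu.mul_right_cancel ?_
      rw [mul_assoc, h1]
      noncomm_ring
    have e2 : (1 - h) * v * (star v * (1 - h)) = (1 - h) * (1 - h) := by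
      rw [mul_assoc, ← mul_assoc v, hv, one_mul]
    calc _ = (1 + h) * ((1 - h) * (1 - h)) * (1 + h) := by noncomm_ring
      _ = (1 + h) * ((1 - h) * v) * (star v * (1 - h) * (1 + h)) := by
          rw [← e2]; noncomm_ring
      _ = (1 - h) * v * (1 + h) * ((1 + h) * (star v * (1 - h))) := by
          have e3 := congrArg star e1
          simp only [star_mul, star_add, star_sub, star_one, hsa] at e3
          rw [e1, e3]
      _ = _ := by rw [h1, h2]
  have h4 : (1 - h) * (1 - h) * h = 0 := by
    have e : (4 : ℂ) • ((1 - h) * (1 - h) * h) = 0 := by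
      rw [← sub_eq_zero] at h3
      rw [← h3, ← Nat.cast_ofNat (R := ℂ), Nat.cast_smul_eq_nsmul]
      noncomm_ring
    exact (smul_eq_zero_iff_right (by norm_num)).1 e
  -- hence `h` is a projection, `x` a partial isometry, and `v = x + 1 - h`
  have h5 : (1 - h) * h = 0 := by
    rw [← CStarRing.star_mul_self_eq_zero_iff]
    simp only [star_mul, star_sub, star_one, hsa]
    calc _ = h * ((1 - h) * (1 - h) * h) := by noncomm_ring
      _ = 0 := by rw [h4, mul_zero]
  have h6 : x * (1 - h) = 0 := by
    rw [← CStarRing.star_mul_self_eq_zero_iff]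
    simp only [star_mul, star_sub, star_one, hsa]
    calc _ = (1 - h) * h * (1 - h) := by rw [hh]; noncomm_ring
      _ = 0 := by rw [h5, zero_mul]
  have h6' : (1 - h) * star x = 0 := by simpa [hsa] using congrArg star h6
  have h7 : v = x + 1 - h := by
    refine hu.mul_right_cancel ?_
    rw [hw]
    calc _ = (x + 1 - h) * (1 + h) + (x * (1 - h) - (1 - h) * h) := by noncomm_ring
      _ = _ := by rw [h5, h6]; simp
  apply hx.2
  rw [← hh]
  have h8 : x * star x + x * (1 - h) + (1 - h) * star x + ((1 - h) - (1 - h) * h) = 1 := by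
    refine Eq.trans ?_ hv
    rw [h7]
    simp only [star_sub, star_add, star_one, hsa]
    noncomm_ring
  rw [h5, h6, h6', sub_zero, add_zero, add_zero] at h8
  calc h = h + (x * star x + (1 - h) - 1) := by rw [h8, sub_self, add_zero]
    _ = x * star x := by noncomm_ring

/-- Polar decomposition of an element `w` for which `w⋆ w` is close to `1`. -/
theorem exists_isometry_mul_of_norm_lt {C : Type*} [CStarAlgebra C] {w : C}
    (hw : ‖1 - star w * w‖ < 1) : ∃ u s : C, star u * u = 1 ∧ IsUnit s ∧ w = u * s := by
  let _ := CStarAlgebra.spectralOrder C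
  have _ := CStarAlgebra.spectralOrderedRing C
  have hc : IsUnit (star w * w) := by
    have h := (Units.oneSub _ hw).isUnit
    simpa using h
  have h0 : 0 ≤ star w * w := star_mul_self_nonneg w
  have hs : IsUnit (CFC.sqrt (star w * w)) := (CFC.isUnit_sqrt_iff _ h0).2 hc
  have hss := CFC.sqrt_mul_sqrt_self (star w * w) h0
  have hsa : star (CFC.sqrt (star w * w)) = CFC.sqrt (star w * w) :=
    (IsSelfAdjoint.of_nonneg (CFC.sqrt_nonneg _)).star_eq
  set s := CFC.sqrt (star w * w) with hsdef
  have hw' : w = w * Ring.inverse s * s := by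
    rw [mul_assoc, Ring.inverse_mul_cancel _ hs, mul_one]
  refine ⟨w * Ring.inverse s, s, ?_, hs, hw'⟩
  refine hs.mul_left_cancel (hs.mul_right_cancel ?_)
  calc _ = star (w * Ring.inverse s * s) * (w * Ring.inverse s * s) := by
        rw [star_mul (w * Ring.inverse s) s, hsa]; simp only [mul_assoc]
    _ = _ := by rw [← hw', ← hss, mul_one]

/-- An injective image of `C` that comes close to a non-unitary isometry forces `C` to contain a
non-unitary isometry. -/
theorem exists_nonunitary_isometry {C : Type*} [CStarAlgebra C] {Φ : C →⋆ₐ[ℂ] L}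
    (hΦ : Function.Injective Φ) {v : L} (hv : star v * v = 1) (hv' : v * star v ≠ 1) {w : C}
    (hw : ‖Φ w - v‖ < 1 / 3) : ∃ u : C, star u * u = 1 ∧ u * star u ≠ 1 := by
  have hv1 : ‖v‖ ≤ 1 := by
    have h1 := CStarRing.norm_star_mul_self (x := v)
    rw [hv] at h1
    have h2 := CStarRing.norm_star_mul_self (x := (1 : L))
    rw [star_one, one_mul] at h2
    have h3 : ‖(1 : L)‖ ≤ 1 := by nlinarith [norm_nonneg (1 : L)]
    nlinarith [norm_nonneg v]
  have hw1 : ‖Φ w‖ ≤ 4 / 3 := by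
    calc ‖Φ w‖ = ‖(Φ w - v) + v‖ := by rw [sub_add_cancel]
      _ ≤ ‖Φ w - v‖ + ‖v‖ := norm_add_le _ _
      _ ≤ 4 / 3 := by linarith
  have hlt : ‖1 - star w * w‖ < 1 := by
    rw [norm_sub_rev, ← NonUnitalStarAlgHom.norm_map Φ hΦ]
    have h1 : Φ (star w * w - 1) = star (Φ w) * (Φ w - v) + star (Φ w - v) * v := by
      rw [map_sub, map_mul, map_star, map_one, ← hv, star_sub]
      noncomm_ring
    rw [h1]
    calc _ ≤ ‖star (Φ w)‖ * ‖Φ w - v‖ + ‖star (Φ w - v)‖ * ‖v‖ :=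
          (norm_add_le _ _).trans (add_le_add (norm_mul_le _ _) (norm_mul_le _ _))
      _ ≤ 4 / 3 * ‖Φ w - v‖ + ‖Φ w - v‖ * 1 := by rw [norm_star, norm_star]; gcongr
      _ < 1 := by linarith
  obtain ⟨u, s, hu, hs, rfl⟩ := exists_isometry_mul_of_norm_lt hlt
  refine ⟨u, hu, fun hu' => hv' ?_⟩
  have huu : IsUnit u := ⟨⟨u, star u, hu', hu⟩, rfl⟩
  have hunit : IsUnit (Φ (u * s)) := (huu.mul hs).map Φ
  -- `v⋆ Φ(w)` is within distance `1` of `v⋆ v = 1`, so `v⋆` is invertible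
  have h1 : IsUnit (star v * Φ (u * s)) := by
    have h2 : ‖1 - star v * Φ (u * s)‖ < 1 := by
      have : 1 - star v * Φ (u * s) = star v * (v - Φ (u * s)) := by rw [mul_sub, hv]
      rw [this]
      calc _ ≤ ‖star v‖ * ‖v - Φ (u * s)‖ := norm_mul_le _ _
        _ ≤ 1 * ‖v - Φ (u * s)‖ := by rw [norm_star]; gcongr
        _ < 1 := by rw [norm_sub_rev]; linarith
    have h3 := (Units.oneSub _ h2).isUnit
    simpa using h3
  have h4 : IsUnit (star v) := by
    obtain ⟨z, hz⟩ := hunit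
    rw [← hz] at h1
    exact (Units.isUnit_mul_units _ z).1 h1
  refine h4.mul_left_cancel ?_
  rw [← mul_assoc, hv, one_mul, mul_one]

end Isometry

/-! ### Stable finiteness -/

section Finite

/-- An element `μ + M` of the unitization of `M_n(A)` that is an isometry is unitary, if `A` embeds
in a C⋆-algebra `B` with identity `e` such that no `M_n(B)` contains an infinite projection: the
identity of `M_n(B)` is equivalent to its subprojection `V V⋆`, for `V` the image of `μ + M`. -/
theorem NoInfiniteProjections.mul_star_eq_zero {A B : Type*} [NonUnitalCStarAlgebra A]
    [NonUnitalCStarAlgebra B] (hB : NoInfiniteProjections B) {j : A →⋆ₙₐ[ℂ] B}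
    (hj : Function.Injective j) {e : B} (he : ∀ b, e * b = b ∧ b * e = b) {n : ℕ}
    {M : CStarMatrix (Fin n) (Fin n) A} {μ : ℂ} (hμ : star μ * μ = 1)
    (h : star μ • M + μ • star M + star M * M = 0) :
    star μ • M + μ • star M + M * star M = 0 := by
  by_contra hne
  let _ := CStarAlgebra.spectralOrder B
  have _ := CStarAlgebra.spectralOrderedRing B
  have hes : star e = e := by
    have h1 : e * star e = star e := (he _).1
    have h2 := congrArg star h1
    rw [star_mul, star_star, h1] at h2
    exact h2
  let J := CStarMatrix.mapₙₐ (n := Fin n) j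
  have hJ : ∀ X, J X = 0 → X = 0 := fun X hX => by
    ext a b
    exact (map_eq_zero_iff j hj).1 (congrFun (congrFun hX a) b)
  let p : CStarMatrix (Fin n) (Fin n) B := CStarMatrix.ofMatrix (Matrix.diagonal fun _ => e)
  have hp1 : ∀ X, p * X = X := fun X => by
    ext a b
    exact (Matrix.diagonal_mul (fun _ => e) X a b).trans (he _).1
  have hp2 : ∀ X, X * p = X := fun X => by
    ext a b
    exact (Matrix.mul_diagonal (fun _ => e) X a b).trans (he _).2
  have hps : star p = p := by
    change (Matrix.diagonal (fun _ => e) : Matrix (Fin n) (Fin n) B).conjTranspose = _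
    rw [Matrix.diagonal_conjTranspose]
    congr 1
    funext _
    exact hes
  have hμ' : μ * star μ = 1 := by rw [mul_comm]; exact hμ
  refine hB n p ⟨⟨hp1 p, hps⟩, μ • p + J M, ?_, hp1 _, fun h' => hne (hJ _ ?_)⟩
  · have h1 := congrArg J h
    simp only [map_add, map_smul, map_star, map_mul, map_zero] at h1
    simp only [star_add, star_smul, hps, add_mul, mul_add, smul_mul_assoc, mul_smul_comm, hp1,
      hp2, smul_add, smul_smul, hμ']
    rw [one_smul]
    calc _ = p + (star μ • J M + μ • star (J M) + star (J M) * J M) := by abel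
      _ = p := by rw [h1, add_zero]
  · simp only [star_add, star_smul, hps, add_mul, mul_add, smul_mul_assoc, mul_smul_comm, hp1,
      hp2, smul_add, smul_smul, hμ] at h'
    rw [one_smul] at h'
    simp only [map_add, map_smul, map_star, map_mul]
    rw [← add_right_inj p, add_zero]
    refine Eq.trans ?_ h'
    abel

/-- Over a stably finite `A`, every isometry in the unitization of `M_n(A)` is unitary. -/
theorem IsStablyFinite.mul_star_eq_one {A : Type*} [NonUnitalCStarAlgebra A]
    [PartialOrder A] [StarOrderedRing A] (hA : IsStablyFinite A) {n : ℕ}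
    {u : Unitization ℂ (CStarMatrix (Fin n) (Fin n) A)} (hu : star u * u = 1) :
    u * star u = 1 := by
  have h1 := congrArg (fun z => z.fst) hu
  have h2 := congrArg (fun z => z.snd) hu
  simp only [Unitization.fst_mul, Unitization.snd_mul, Unitization.fst_star, Unitization.snd_star,
    Unitization.fst_one, Unitization.snd_one] at h1 h2
  have key : star u.fst • u.snd + u.fst • star u.snd + u.snd * star u.snd = 0 := by
    by_cases hid : HasIdentity A
    · obtain ⟨e, he⟩ := hid
      exact (hA.1 ⟨e, he⟩).mul_star_eq_zero (j := NonUnitalStarAlgHom.id ℂ A)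
        Function.injective_id he h1 h2
    · exact (hA.2 hid).mul_star_eq_zero (j := Unitization.inrNonUnitalStarAlgHom ℂ A)
        Unitization.inr_injective (e := 1) (fun b => ⟨one_mul b, mul_one b⟩) h1 h2
  refine Unitization.ext ?_ ?_
  · simpa [mul_comm] using h1
  · simp only [Unitization.snd_mul, Unitization.fst_star, Unitization.snd_star,
      Unitization.snd_one]
    rw [← key]
    abel

/-- The unital extension of `matrixHom` is injective: `ℓ²(A)` has a coordinate on which finite
matrices vanish. -/
theorem starLift_matrixHom_injective {A : Type*} [NonUnitalCStarAlgebra A] [PartialOrder A]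
    [StarOrderedRing A] [Nontrivial A] (n : ℕ) :
    Function.Injective (Unitization.starLift (matrixHom A n)) := by
  refine (injective_iff_map_eq_zero _).2 fun u hu => ?_
  have h1 : algebraMap ℂ (Adjointable A (StdModule A)) u.fst + matrixHom A n u.snd = 0 := by
    exact hu
  have h2 : u.fst = 0 := by
    obtain ⟨a, ha⟩ := exists_ne (0 : A)
    have h3 := congrArg (fun T : Adjointable A (StdModule A) => T (StdModule.single n a) n) h1
    simp only [Algebra.algebraMap_eq_smul_one, Adjointable.add_apply, Adjointable.smul_apply,
      Adjointable.one_apply, StdModule.add_apply, StdModule.smul_apply, matrixHom_apply_single,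
      StdModule.single_apply_self, lt_irrefl, false_and, dite_false, add_zero] at h3
    exact (smul_eq_zero.1 h3).resolve_right ha
  rw [h2, map_zero, zero_add] at h1
  exact Unitization.ext h2 (matrixHom_injective n (h1.trans (map_zero _).symm))

/-- The stabilization of a stably finite C⋆-algebra contains no scaling element. -/
theorem IsStablyFinite.not_stabilizationHasScalingElement {A : Type*} [NonUnitalCStarAlgebra A]
    [PartialOrder A] [StarOrderedRing A] (hA : IsStablyFinite A) :
    ¬ StabilizationHasScalingElement A := by
  rintro ⟨⟨x, hxmem⟩, hx1, hx2⟩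
  have hx : IsScalingElement x :=
    ⟨congrArg Subtype.val hx1, fun h => hx2 (Subtype.ext h)⟩
  cases subsingleton_or_nontrivial A with
  | inl hsub =>
    refine hx.2 (Adjointable.ext fun ξ => StdModule.ext fun i => Subsingleton.elim _ _)
  | inr hnt =>
    obtain ⟨y, hy, hyD⟩ := mem_closure_iff_nhds.1 (stabilization_le_closure hxmem) _
      (continuous_scalingIsometry.continuousAt.preimage_mem_nhds
        (Metric.ball_mem_nhds (scalingIsometry x) (show (0 : ℝ) < 1 / 3 by norm_num)))
    obtain ⟨n, M, hM⟩ := (mem_finiteMatrices.1 hyD).exists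
    have hM : matrixHom A n M = y := hM
    obtain ⟨u, hu, hu'⟩ := exists_nonunitary_isometry (starLift_matrixHom_injective n)
      hx.star_mul_scalingIsometry hx.scalingIsometry_mul_star_ne
      (w := scalingIsometry (M : Unitization ℂ (CStarMatrix (Fin n) (Fin n) A))) (by
        rw [map_scalingIsometry]
        have : Unitization.starLift (matrixHom A n) (M : Unitization ℂ _) = y := by
          change algebraMap ℂ (Adjointable A (StdModule A)) 0 + matrixHom A n M = y
          rw [map_zero, zero_add, hM]
        rw [this, ← dist_eq_norm]
        exact hy)
    exact hu' (hA.mul_star_eq_one hu)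

end Finite

end HilbertMod

theorem mainTheorem4
    {A : Type*} [NonUnitalCStarAlgebra A] [PartialOrder A] [StarOrderedRing A]
    [TopologicalSpace.SeparableSpace A]
    {F : Type*} [NormedAddCommGroup F] [NormedSpace ℂ F] [CompleteSpace F]
    [SMul Aᵐᵒᵖ F] [CStarModule Aᵐᵒᵖ F]
    (hF : HilbertMod.IsCountablyGenerated A F)
    (E : Submodule ℂ F) (hE : HilbertMod.IsCompactlyContained A E) :
    (HilbertMod.IsIsomorphicToWhole A E →
      E = ⊤ ∨ HilbertMod.StabilizationHasScalingElement A) ∧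
    (HilbertMod.IsStablyFinite A →
      ¬ HilbertMod.StabilizationHasScalingElement A ∧
      (HilbertMod.IsIsomorphicToWhole A E ↔ E = ⊤)) := by
  refine ⟨hE.eq_top_or_scaling hF, fun hA => ?_⟩
  have hns := hA.not_stabilizationHasScalingElement
  refine ⟨hns, fun h => (hE.eq_top_or_scaling hF h).resolve_right hns, ?_⟩
  rintro rfl
  exact ⟨Submodule.topEquiv, fun a x y h => h, fun x y => rfl⟩
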